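/- Let $\mathbb K\in\{\mathbb R,\mathbb C\}$ and $n_2,n_3\ge 1$. Let $\mathcal L:\mathbb K^{n_3}\to\mathbb K^{n_3}$ be an invertible linear transform of tubes with $\|\mathcal L(a)\|_2=c\|a\|_2$ for all $a$, where $c>0$ is a constant. For third-order tensors, regarded as matrices of tubes of length $n_3$, let $\mathcal L$ act on each tube; let $a\bullet b=\mathcal L^{-1}(\mathcal L(a)\circ\mathcal L(b))$ for tubes ($\circ$ is the entrywise product), $(\mathcal A\bullet\mathcal B)(i,j,:)=\sum_s\mathcal A(i,s,:)\bullet\mathcal B(s,j,:)$, and let $\mathcal A^\dagger$ be given by $\mathcal L(\mathcal A^{\dagger})^{(k)}=(\mathcal L(\mathcal A)^{(k)})^H$ on each frontal slice. The unit tube is $e=\mathcal L^{-1}(\mathbf 1)$, and the identity tensor $\mathcal I$ has $e$'s on its diagonal and zero tubes elsewhere; invertibility of square tensors is with respect to $\bullet$ and $\mathcal I$. Let $\mathcal U\in\mathbb K^{n_1\times n_2\times n_3}$ be such that $\mathcal U^\dagger\bullet\mathcal U$ is invertible (for instance $\mathcal U^\dagger\bullet\mathcal U=\mathcal I$), let $\mathcal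 S=\{\sum_{j}\mathcal U(:,j,:)\bullet c_j: c_j\in\mathbb K^{n_3}\}\subset\mathbb K^{n_1\times1\times n_3}$, let $\mathcal P=\mathcal U\bullet(\mathcal U^\dagger\bullet\mathcal U)^{-1}\bullet\mathcal U^\dagger$, and let $$\mu(\mathcal S)=\frac{n_1}{n_2}\max_{1\le j\le n_1}\|\mathcal P\bullet\mathcal E_j\|_F^2$$ be the coherence of $\mathcal S$, where $\mathcal E_j\in\mathbb K^{n_1\times 1\times n_3}$ has $j$-th tube $e$ and all other tubes zero. Let $\mathcal T=\mathcal X+\mathcal Y\in\mathbb K^{n_1\times 1\times n_3}$ with $\mathcal X\in\mathcal S$ and $\mathcal Y\in\mathcal S^\perp$ (orthogonality for the Frobenius inner product), and let $\|\mathcal Y\|_{\infty^*}=\max_i\|\mathcal Y(i,1,:)\|_2$. Let $\Omega(1),\dots,\Omega(m)$ be independent and uniformly distributed on $\{1,\dots,n_1\}$. Write $\mathcal T_\Omega(i,:,:)=\mathcal T(\Omega(i),:,:)$ and $\mathcal U_\Omega(i,:,:)=\mathcal U(\Omega(i),:,:)$ for $1\le i\le m$, and $\mathcal P_\Omega=\mathcal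 U_\Omega\bullet(\mathcal U_\Omega^\dagger\bullet\mathcal U_\Omega)^{-1}\bullet\mathcal U_\Omega^\dagger$. Let $\delta>0$ and put $$\alpha=\sqrt{\frac{2(n_1\|\mathcal Y\|_{\infty^*}^2-\|\mathcal Y\|_F^2)}{m\|\mathcal Y\|_F^2}\log\frac1\delta}+\frac{2(n_1\|\mathcal Y\|_{\infty^*}^2-\|\mathcal Y\|_F^2)}{3m\|\mathcal Y\|_F^2}\log\frac1\delta,$$ $$\beta=\Bigl(1+2\sqrt{\log\tfrac1\delta}\Bigr)^2,\qquad \gamma=\sqrt{\frac{8c^2n_2\mu(\mathcal S)}{3m}\log\frac{2n_2n_3}{\delta}}$$ (with $\alpha=0$ if $\mathcal Y=0$). Suppose that $m\ge\frac83n_2\mu(\mathcal S)\log\frac{2n_2n_3}{\delta}$ and that $\gamma<1$. Then, with probability at least $1-4\delta$, the tensor $\mathcal U_\Omega^\dagger\bullet\mathcal U_\Omega$ is invertible (so that $\mathcal P_\Omega$ is defined) and $$\frac{m(1-\alpha)-c^2n_2\mu(\mathcal S)\frac{\beta}{1-\gamma}}{n_1}\|\mathcal T-\mathcal P\bullet\mathcal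 T\|_F^2\le\|\mathcal T_\Omega-\mathcal P_\Omega\bullet\mathcal T_\Omega\|_F^2\le(1+\alpha)\frac m{n_1}\|\mathcal T-\mathcal P\bullet\mathcal T\|_F^2 .$$ (For $\delta\ge\frac14$ there is nothing to prove; square roots of negative numbers are then read as $0$.) -/

import Mathlib

/-! Third-order tensors, the product of tensors induced by an invertible transform of tubes, and
random sampling of horizontal slices.  The scalar field `𝕜` is `ℝ` or `ℂ` (the latter covers
complex transforms such as the discrete Fourier transform; real tensors are then particular
complex tensors). -/

open MeasureTheory ProbabilityTheory

noncomputable section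

/-- Tubes of length `n`. -/
abbrev Tube (𝕜 : Type*) (n : ℕ) : Type _ := Fin n → 𝕜

/-- Third-order tensors of size `a × b × n`, as `a × b` matrices of tubes of length `n`. -/
abbrev Tensor3 (𝕜 : Type*) (a b n : ℕ) : Type _ := Fin a → Fin b → Tube 𝕜 n

/-- An invertible linear transform of tubes (a linear bijection is the same as an invertible
matrix). -/
abbrev TubeTransform (𝕜 : Type*) [RCLike 𝕜] (n : ℕ) : Type _ := Tube 𝕜 n ≃ₗ[𝕜] Tube 𝕜 n

section Norms

variable {𝕜 : Type*} [RCLike 𝕜] {a b n : ℕ}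

/-- The Euclidean norm of a tube. -/
def tubeNorm (x : Tube 𝕜 n) : ℝ := √(∑ k, ‖x k‖ ^ 2)

/-- The Frobenius norm of a tensor. -/
def frobNorm (A : Tensor3 𝕜 a b n) : ℝ := √(∑ i, ∑ j, ∑ k, ‖A i j k‖ ^ 2)

/-- The Frobenius inner product of two tensors. -/
def frobInner (A B : Tensor3 𝕜 a b n) : 𝕜 := ∑ i, ∑ j, ∑ k, star (A i j k) * B i j k

/-- For a tensor column, the largest Euclidean norm of its tubes. -/
def maxTubeNorm (X : Tensor3 𝕜 a 1 n) : ℝ := ⨆ i, tubeNorm (X i 0)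

end Norms

section Product

variable {𝕜 : Type*} [RCLike 𝕜] {a b d n : ℕ} (L : TubeTransform 𝕜 n)

/-- Multiplication of tubes: entrywise multiplication in the transform domain. -/
def tubeMul (x y : Tube 𝕜 n) : Tube 𝕜 n := L.symm (fun k => L x k * L y k)

/-- The multiplicative unit for `tubeMul`. -/
def tubeOne : Tube 𝕜 n := L.symm (fun _ => 1)

/-- The product of tensors: multiplication of matrices of tubes. -/
def tensorMul (A : Tensor3 𝕜 a b n) (B : Tensor3 𝕜 b d n) : Tensor3 𝕜 a d n :=
  fun i j => ∑ s, tubeMul L (A i s) (B s j)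

/-- The tensor transpose: each frontal slice in the transform domain is replaced by its conjugate
transpose. -/
def ttranspose (A : Tensor3 𝕜 a b n) : Tensor3 𝕜 b a n :=
  fun i j => L.symm (fun k => star (L (A j i) k))

/-- The identity tensor. -/
def tid (a : ℕ) : Tensor3 𝕜 a a n := fun i j => if i = j then tubeOne L else 0

/-- `B` is the (two-sided) inverse of the square tensor `A`. -/
def IsTInverse (A B : Tensor3 𝕜 a a n) : Prop :=
  tensorMul L A B = tid L a ∧ tensorMul L B A = tid L a

/-- `P = U • (U† • U)⁻¹ • U†`, including the claim that `U† • U` is invertible. -/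
def IsColProjection (U : Tensor3 𝕜 a b n) (P : Tensor3 𝕜 a a n) : Prop :=
  ∃ W : Tensor3 𝕜 b b n, IsTInverse L (tensorMul L (ttranspose L U) U) W ∧
    P = tensorMul L (tensorMul L U W) (ttranspose L U)

/-- The tensor-column subspace spanned by the columns of `U`. -/
def colSubspace (U : Tensor3 𝕜 a b n) : Set (Tensor3 𝕜 a 1 n) :=
  {X | ∃ x : Fin b → Tube 𝕜 n, ∀ i, X i 0 = ∑ j, tubeMul L (U i j) (x j)}

/-- The orthogonal complement of a set of tensor columns. -/
def orthComplement (S : Set (Tensor3 𝕜 a 1 n)) : Set (Tensor3 𝕜 a 1 n) :=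
  {Y | ∀ X ∈ S, frobInner X Y = 0}

/-- The tensor column with the unit tube in position `j` and zeros elsewhere. -/
def basisColumn (j : Fin a) : Tensor3 𝕜 a 1 n := fun i _ => if i = j then tubeOne L else 0

/-- The coherence of an `r`-dimensional tensor-column subspace of `𝕜^(a × 1 × n)` with orthogonal
projection `P`. -/
def coherence (r : ℕ) (P : Tensor3 𝕜 a a n) : ℝ :=
  (a : ℝ) / r * ⨆ j : Fin a, frobNorm (tensorMul L P (basisColumn L j)) ^ 2

end Product

/-- The tensor whose horizontal slices are those of `A` with the indices `s 0, s 1, …`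
(repetitions allowed). -/
def sampleRows {𝕜 : Type*} {a b n m : ℕ} (s : Fin m → Fin a) (A : Tensor3 𝕜 a b n) :
    Tensor3 𝕜 m b n :=
  fun i => A (s i)

/-- The quantity `α` of the bound. -/
def alphaBound {𝕜 : Type*} [RCLike 𝕜] {a n : ℕ} (m : ℕ) (δ : ℝ) (Y : Tensor3 𝕜 a 1 n) : ℝ :=
  √(2 * (a * maxTubeNorm Y ^ 2 - frobNorm Y ^ 2) / (m * frobNorm Y ^ 2) * Real.log (1 / δ)) +
    2 * (a * maxTubeNorm Y ^ 2 - frobNorm Y ^ 2) / (3 * m * frobNorm Y ^ 2) * Real.log (1 / δ)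

/-- The quantity `β` of the bound. -/
def betaBound (δ : ℝ) : ℝ := (1 + 2 * √(Real.log (1 / δ))) ^ 2

/-- The quantity `γ` of the bound, for coherence `μ`, dimension `r` and tube length `n`. -/
def gammaBound (c μ δ : ℝ) (m r n : ℕ) : ℝ :=
  √(8 * c ^ 2 * r * μ / (3 * m) * Real.log (2 * r * n / δ))

end

/-! In the transform domain `•` is matrix multiplication on each frontal slice, and squared
Frobenius norms are multiplied by c², so the claim concerns n₃ least squares problems sharing one
sample of rows. Write each slice of U as Q C with Qᴴ Q = 1 and C invertible, and let y be the slice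
of Y, so that Qᴴ y = 0. The full residual is Y itself. If the sampled Gram matrix of Q is at least λ
= (1 - γ)m/n₁, the sampled residual lies between ‖y_Ω‖² - ‖Q_Ωᴴ y_Ω‖²/λ and ‖y_Ω‖²
(`exists_leastSquares_residual_bounds`).

It remains to exclude few samples: those where ∑ ‖y_Ω‖² is far from its mean (`bernstein_sampling`,
each tail costing δ), where some Gram matrix is badly conditioned (`matrix_chernoff_sampling` and a
union bound over slices, δ/2), or where ∑ ‖Q_Ωᴴ y_Ω‖² is large (`norm_sum_sampling`, δ).

All three inequalities have one proof: a potential of the partial sums grows on average by at most a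
fixed factor per draw, and Markov's inequality counts the bad paths. The potentials are the
exponential, cosh of the norm, and the trace of the matrix exponential. For the last, the increments
have rank one, so Peierls' inequality and `quadForm_exp_add_le` can replace Golden–Thompson.

With ℓ = log(1/δ), the lower Bernstein tail loses (2/3)ℓ beyond α. The vector inequality is
therefore proved with β - (2/3)ℓ in place of β, and c² n₂ μ ≥ 1 lets this gain pay for that loss. -/

/-! ### Potentials along sampled paths -/

/-- If a potential grows on average by at most a factor under a random step, its sum over all paths
grows geometrically. -/
theorem sum_paths_le {α E : Type*} [Fintype α] [AddCommMonoid E] (Φ : E → ℝ) (p : E → Prop)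
    (z : α → E) {B : ℝ} (hB : 0 ≤ B) (hp : ∀ s j, p s → p (s + z j))
    (h : ∀ s, p s → ∑ j, Φ (s + z j) ≤ B * Φ s) (m : ℕ) (s₀ : E) (h₀ : p s₀) :
    ∑ s : Fin m → α, Φ (s₀ + ∑ i, z (s i)) ≤ B ^ m * Φ s₀ := by
  induction m generalizing s₀ with
  | zero => simp
  | succ m ih =>
    rw [← (Fin.consEquiv (fun _ : Fin (m + 1) => α)).sum_comp, Fintype.sum_prod_type]
    calc _ = ∑ j, ∑ s : Fin m → α, Φ ((s₀ + z j) + ∑ i, z (s i)) := by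
          refine Finset.sum_congr rfl fun j _ => Finset.sum_congr rfl fun s _ => ?_
          simp [Fin.consEquiv, Fin.sum_univ_succ, add_assoc]
      _ ≤ ∑ j, B ^ m * Φ (s₀ + z j) := Finset.sum_le_sum fun j _ => ih _ (hp _ _ h₀)
      _ = B ^ m * ∑ j, Φ (s₀ + z j) := by rw [Finset.mul_sum]
      _ ≤ B ^ m * (B * Φ s₀) := by gcongr; exact h _ h₀
      _ = B ^ (m + 1) * Φ s₀ := by ring

/-- Markov's inequality in counting form. The predicate `p` is an invariant of the partial sums,
needed for matrices, where the one-step bound holds only at Hermitian arguments. -/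
theorem card_paths_mul_le {α E : Type*} [Fintype α] [AddCommMonoid E] (Φ : E → ℝ) (p : E → Prop)
    (z : α → E) {B : ℝ} (hB : 0 ≤ B) (hp : ∀ s j, p s → p (s + z j)) (h₀ : p 0)
    (h : ∀ s, p s → ∑ j, Φ (s + z j) ≤ B * Φ s) (m : ℕ) (hΦ : ∀ s, p s → 0 ≤ Φ s) (τ : ℝ)
    (A : Finset (Fin m → α)) (hA : ∀ s : Fin m → α, s ∈ A → τ ≤ Φ (∑ i, z (s i))) :
    A.card * τ ≤ B ^ m * Φ 0 := by
  have hps : ∀ (t : Finset (Fin m)) (s : Fin m → α), p (∑ i ∈ t, z (s i)) := by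
    intro t s
    classical
    induction t using Finset.induction_on with
    | empty => simpa using h₀
    | insert a t ha ih => rw [Finset.sum_insert ha, add_comm]; exact hp _ _ ih
  calc A.card * τ = ∑ _s ∈ A, τ := by simp
    _ ≤ ∑ s ∈ A, Φ (∑ i, z (s i)) := Finset.sum_le_sum hA
    _ ≤ ∑ s : Fin m → α, Φ (∑ i, z (s i)) :=
        Finset.sum_le_sum_of_subset_of_nonneg (Finset.subset_univ _) fun s _ _ => hΦ _ (hps _ s)
    _ ≤ B ^ m * Φ 0 := by
        simpa using sum_paths_le Φ p z hB hp h m 0 h₀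

/-! ### Scalar Bernstein inequality -/

/-- The difference of the sides vanishes to first order at 0 and is convex: its second derivative is
(1 - eʸ(1 - y))/3, and 1 - y ≤ e⁻ʸ. -/
theorem exp_mul_one_sub_div_three_le (y : ℝ) :
    Real.exp y * (1 - y / 3) ≤ 1 + 2 * y / 3 + y ^ 2 / 6 := by
  let g : ℝ → ℝ := fun y => 1 + 2 * y / 3 + y ^ 2 / 6 - Real.exp y * (1 - y / 3)
  let g' : ℝ → ℝ := fun y => 2 / 3 + y / 3 - Real.exp y * (2 / 3 - y / 3)
  have hg : ∀ y, HasDerivAt g (g' y) y := by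
    intro y
    have h := ((((hasDerivAt_id y).const_mul 2).div_const 3).const_add 1).add
      (((hasDerivAt_id y).pow 2).div_const 6)
    have h2 := (Real.hasDerivAt_exp y).mul (((hasDerivAt_id y).div_const 3).const_sub 1)
    refine (h.sub h2).congr_deriv ?_
    simp [g']
    ring
  have hg' : ∀ y, HasDerivAt g' (1 / 3 - Real.exp y * (1 / 3 - y / 3)) y := by
    intro y
    have h := ((hasDerivAt_id y).div_const 3).const_add (2 / 3)
    have h2 := (Real.hasDerivAt_exp y).mul (((hasDerivAt_id y).div_const 3).const_sub (2 / 3))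
    refine (h.sub h2).congr_deriv ?_
    simp
    ring
  have hmono : Monotone g' := by
    refine monotone_of_deriv_nonneg (fun y => (hg' y).differentiableAt) fun y => ?_
    rw [(hg' y).deriv]
    have h1 := Real.add_one_le_exp (-y)
    have h2 : Real.exp y * Real.exp (-y) = 1 := by rw [← Real.exp_add]; simp
    nlinarith [Real.exp_pos y, mul_le_mul_of_nonneg_left h1 (Real.exp_pos y).le]
  have h0 : g' 0 = 0 := by simp [g']
  have hcont : Continuous g := continuous_iff_continuousAt.2 fun y => (hg y).continuousAt
  have key : 0 ≤ g y := by
    have hg0 : g 0 = 0 := by simp [g]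
    rcases le_total 0 y with hy | hy
    · have : MonotoneOn g (Set.Ici 0) := by
        refine monotoneOn_of_deriv_nonneg (convex_Ici 0) hcont.continuousOn
          (fun y _ => (hg y).differentiableAt.differentiableWithinAt) fun y hy => ?_
        rw [(hg y).deriv, ← h0]
        simp only [interior_Ici, Set.mem_Ioi] at hy
        exact hmono hy.le
      rw [← hg0]; exact this (by simp) hy hy
    · have : AntitoneOn g (Set.Iic 0) := by
        refine antitoneOn_of_deriv_nonpos (convex_Iic 0) hcont.continuousOn
          (fun y _ => (hg y).differentiableAt.differentiableWithinAt) fun y hy => ?_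
        rw [(hg y).deriv, ← h0]
        simp only [interior_Iic, Set.mem_Iio] at hy
        exact hmono hy.le
      rw [← hg0]; exact this hy (by simp) hy
  simp only [g] at key
  linarith

/-- Nothing is asked of `y` from below, which is why a one-sided bound on the population suffices in
Bernstein's inequality. -/
theorem exp_le_one_add_add_sq_div {y Y : ℝ} (hy : y ≤ Y) (hY : Y < 3) :
    Real.exp y ≤ 1 + y + y ^ 2 / (2 * (1 - Y / 3)) := by
  have h1 : 0 < 1 - Y / 3 := by linarith
  have h2 : 0 < 1 - y / 3 := by linarith
  have h3 : Real.exp y ≤ (1 + 2 * y / 3 + y ^ 2 / 6) / (1 - y / 3) :=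
    (le_div_iff₀ h2).2 (exp_mul_one_sub_div_three_le y)
  have h4 : (1 + 2 * y / 3 + y ^ 2 / 6) / (1 - y / 3) = 1 + y + y ^ 2 / (2 * (1 - y / 3)) := by
    rw [div_eq_iff h2.ne', add_mul _ (y ^ 2 / _), show y ^ 2 / (2 * (1 - y / 3)) * (1 - y / 3) = y ^ 2 / 2 by
      rw [div_mul_eq_mul_div, mul_div_mul_right _ _ h2.ne']]
    ring
  have h5 : y ^ 2 / (2 * (1 - y / 3)) ≤ y ^ 2 / (2 * (1 - Y / 3)) := by gcongr
  linarith

/-- Bernstein's inequality for sampling with replacement from a finite centred population. -/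
theorem bernstein_sampling {α : Type*} [Fintype α] (x : α → ℝ) (hx : ∑ j, x j = 0)
    {b v ℓ : ℝ} (hb : 0 ≤ b) (hxb : ∀ j, x j ≤ b) (hℓ : 0 < ℓ)
    (hv : ∑ j, x j ^ 2 ≤ Fintype.card α * v) (m : ℕ) (A : Finset (Fin m → α))
    (hA : ∀ s ∈ A, √(2 * m * v * ℓ) + 2 * b * ℓ / 3 < ∑ i, x (s i)) :
    A.card ≤ (Fintype.card α : ℝ) ^ m * Real.exp (-ℓ) := by
  rcases A.eq_empty_or_nonempty with rfl | ⟨s₀, hs₀⟩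
  · simp; positivity
  have hm : 0 < m := by
    rcases Nat.eq_zero_or_pos m with rfl | h
    · have := hA _ hs₀
      simp at this
      exact absurd this (not_lt.2 (by positivity))
    · exact h
  have hcard : 0 < Fintype.card α := Fintype.card_pos_iff.2 ⟨s₀ ⟨0, hm⟩⟩
  have hc' : (0 : ℝ) < Fintype.card α := by exact_mod_cast hcard
  have hv0 : 0 ≤ v := by
    have : 0 ≤ ∑ j, x j ^ 2 := by positivity
    by_contra h
    push Not at h
    nlinarith
  rcases hv0.eq_or_lt with rfl | hvp
  · have h0 : ∀ j, x j = 0 := by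
      intro j
      have h1 : x j ^ 2 ≤ 0 := by
        refine le_trans ?_ (hv.trans (by simp))
        exact Finset.single_le_sum (f := fun j => x j ^ 2) (fun _ _ => by positivity)
          (Finset.mem_univ j)
      nlinarith
    have := hA _ hs₀
    simp [h0] at this
    exact absurd this (not_lt.2 (by positivity))
  have hm' : (0 : ℝ) < m := by exact_mod_cast hm
  -- `r` is the optimal parameter for a purely Gaussian tail. Dividing it by `D` makes 1 - λb/3
  -- equal to 1/D, which keeps the exponent explicit.
  set r := √(2 * ℓ / (m * v)) with hr
  have hrp : 0 < r := Real.sqrt_pos.2 (by positivity)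
  have hr2 : r ^ 2 * (m * v) = 2 * ℓ := by
    rw [hr, Real.sq_sqrt (by positivity)]; field_simp
  have hrs : r * √(2 * m * v * ℓ) = 2 * ℓ := by
    rw [hr, ← Real.sqrt_mul (by positivity), show 2 * ℓ / (m * v) * (2 * m * v * ℓ) = (2 * ℓ) ^ 2 by
      field_simp]
    exact Real.sqrt_sq (by positivity)
  set D := 1 + b / 3 * r with hD
  have hDp : 0 < D := by positivity
  set lam := r / D with hlam
  have hlp : 0 < lam := by positivity
  have h1l : 1 - lam * b / 3 = 1 / D := by rw [hlam]; field_simp; rw [hD]; ring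
  have hlb : lam * b < 3 := by
    have : 0 < 1 / D := by positivity
    linarith
  set t := √(2 * m * v * ℓ) + 2 * b * ℓ / 3
  have hstep : ∑ j, Real.exp (lam * x j) ≤ Fintype.card α * Real.exp (lam ^ 2 * v / (2 * (1 / D))) := by
    calc ∑ j, Real.exp (lam * x j)
        ≤ ∑ j, (1 + lam * x j + (lam * x j) ^ 2 / (2 * (1 / D))) := by
          refine Finset.sum_le_sum fun j _ => ?_
          rw [← h1l]
          exact exp_le_one_add_add_sq_div (mul_le_mul_of_nonneg_left (hxb j) hlp.le) hlb
      _ = Fintype.card α + lam ^ 2 / (2 * (1 / D)) * ∑ j, x j ^ 2 := by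
          rw [Finset.sum_add_distrib, Finset.sum_add_distrib, ← Finset.mul_sum, hx,
            Finset.mul_sum]
          simp only [mul_zero, add_zero, Finset.sum_const, Finset.card_univ, nsmul_eq_mul, mul_one]
          congr 1
          exact Finset.sum_congr rfl fun j _ => by ring
      _ ≤ Fintype.card α + lam ^ 2 / (2 * (1 / D)) * (Fintype.card α * v) := by gcongr
      _ = Fintype.card α * (lam ^ 2 * v / (2 * (1 / D)) + 1) := by ring
      _ ≤ _ := by gcongr; exact Real.add_one_le_exp _
  have key := card_paths_mul_le (fun s : ℝ => Real.exp (lam * s)) (fun _ => True) x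
    (B := Fintype.card α * Real.exp (lam ^ 2 * v / (2 * (1 / D)))) (by positivity)
    (fun _ _ _ => trivial) trivial
    (fun s _ => by
      simp only [mul_add, Real.exp_add]
      rw [← Finset.mul_sum, mul_comm]
      gcongr) m (fun s _ => (Real.exp_pos _).le) (Real.exp (lam * t)) A
    (fun s hs => by
      have := (hA s hs).le
      exact Real.exp_le_exp.2 (by gcongr))
  simp only [mul_zero, Real.exp_zero, mul_one] at key
  rw [mul_pow, ← Real.exp_nat_mul] at key
  rw [← le_div_iff₀ (Real.exp_pos _), mul_div_assoc, ← Real.exp_sub] at key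
  refine key.trans ?_
  gcongr
  have e1 : m * (lam ^ 2 * v / (2 * (1 / D))) = ℓ / D := by
    rw [hlam]; field_simp; linarith
  have e2 : lam * t = (2 * ℓ + r * (2 * b * ℓ / 3)) / D := by
    rw [hlam, ← hrs]; ring
  -- The exponent is -(ℓ + 2rbℓ/3)/D with D = 1 + rb/3, so rbℓ/3 is to spare.
  rw [e1, e2, ← sub_div, div_le_iff₀ hDp, hD]
  nlinarith [mul_nonneg (mul_nonneg hrp.le hb) hℓ.le]

/-! ### Vector Bernstein inequality -/

/-- cosh w is a power series in w² with nonnegative coefficients, hence convex in w², and w² is the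
average of (a + b)² and (a - b)² with weights (1 ± x)/2. -/
theorem cosh_add_le_of_abs_le_one {a b x w : ℝ} (hx : |x| ≤ 1)
    (hw : w ^ 2 = a ^ 2 + 2 * (a * b * x) + b ^ 2) :
    Real.cosh w ≤ Real.cosh a * Real.cosh b + x * (Real.sinh a * Real.sinh b) := by
  have hx' := abs_le.1 hx
  have h1 := ((Real.hasSum_cosh (a + b)).mul_left ((1 + x) / 2)).add
    ((Real.hasSum_cosh (a - b)).mul_left ((1 - x) / 2))
  have h2 : Real.cosh a * Real.cosh b + x * (Real.sinh a * Real.sinh b) =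
      (1 + x) / 2 * Real.cosh (a + b) + (1 - x) / 2 * Real.cosh (a - b) := by
    rw [Real.cosh_add, Real.cosh_sub]; ring
  rw [h2]
  refine hasSum_le (fun n => ?_) (Real.hasSum_cosh w) h1
  have hc := (convexOn_pow (𝕜 := ℝ) n).2 (Set.mem_Ici.2 (sq_nonneg (a + b)))
    (Set.mem_Ici.2 (sq_nonneg (a - b))) (show 0 ≤ (1 + x) / 2 by linarith)
    (show 0 ≤ (1 - x) / 2 by linarith) (by ring)
  simp only [smul_eq_mul] at hc
  have hw' : w ^ (2 * n) = ((1 + x) / 2 * (a + b) ^ 2 + (1 - x) / 2 * (a - b) ^ 2) ^ n := by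
    rw [pow_mul, hw]; congr 1; ring
  rw [hw', pow_mul, pow_mul, ← mul_div_assoc, ← mul_div_assoc, ← add_div]
  gcongr

/-- The term linear in z is kept apart because it averages to zero over a centred population; `κ` =
sinh‖s‖/‖s‖ depends on s only. What remains, e^‖z‖ - ‖z‖, is 1 up to second order. -/
theorem exists_cosh_norm_add_le {𝕜 E : Type*} [RCLike 𝕜] [NormedAddCommGroup E]
    [InnerProductSpace 𝕜 E] (s : E) :
    ∃ κ : ℝ, ∀ z : E, Real.cosh ‖s + z‖ ≤
      Real.cosh ‖s‖ * (Real.exp ‖z‖ - ‖z‖) + κ * RCLike.re (inner 𝕜 s z) := by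
  obtain ⟨κ, hκ⟩ : ∃ κ, Real.sinh ‖s‖ = ‖s‖ * κ := by
    rcases eq_or_ne ‖s‖ 0 with h | h
    · exact ⟨0, by simp [h]⟩
    · exact ⟨Real.sinh ‖s‖ / ‖s‖, by field_simp⟩
  refine ⟨κ, fun z => ?_⟩
  have hcs : |RCLike.re (inner 𝕜 s z)| ≤ ‖s‖ * ‖z‖ :=
    (RCLike.abs_re_le_norm _).trans (norm_inner_le_norm s z)
  obtain ⟨x, hx1, hx⟩ : ∃ x : ℝ, |x| ≤ 1 ∧ RCLike.re (inner 𝕜 s z) = ‖s‖ * ‖z‖ * x := by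
    rcases eq_or_ne (‖s‖ * ‖z‖) 0 with h | h
    · exact ⟨0, by simp, by rw [h] at hcs ⊢; simpa using hcs⟩
    · refine ⟨RCLike.re (inner 𝕜 s z) / (‖s‖ * ‖z‖), ?_, by rw [mul_div_cancel₀ _ h]⟩
      rw [abs_div, abs_of_nonneg (a := ‖s‖ * ‖z‖) (by positivity)]
      exact div_le_one_of_le₀ hcs (by positivity)
  have h1 := cosh_add_le_of_abs_le_one (a := ‖s‖) (b := ‖z‖) (w := ‖s + z‖) hx1
    (by rw [← hx]; exact norm_add_sq s z)
  have hsb : ‖z‖ ≤ Real.sinh ‖z‖ := Real.self_le_sinh_iff.2 (norm_nonneg _)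
  have hsa : 0 ≤ Real.sinh ‖s‖ := Real.sinh_nonneg_iff.2 (norm_nonneg _)
  have hsc : Real.sinh ‖s‖ ≤ Real.cosh ‖s‖ := (Real.sinh_lt_cosh _).le
  -- Only the excess of sinh‖z‖ over ‖z‖ is estimated crudely; the part linear in ‖z‖ is exactly the
  -- inner product term.
  have h2 : x * (Real.sinh ‖s‖ * (Real.sinh ‖z‖ - ‖z‖)) ≤
      Real.cosh ‖s‖ * (Real.sinh ‖z‖ - ‖z‖) := by
    have h3 : 0 ≤ Real.sinh ‖z‖ - ‖z‖ := by linarith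
    have h4 : x ≤ 1 := (abs_le.1 hx1).2
    nlinarith [mul_nonneg hsa h3, mul_le_mul_of_nonneg_right hsc h3]
  have h5 : κ * RCLike.re (inner 𝕜 s z) = x * (Real.sinh ‖s‖ * ‖z‖) := by rw [hx, hκ]; ring
  rw [h5, ← Real.cosh_add_sinh ‖z‖]
  nlinarith

/-- A Bernstein-type inequality for sums of vectors sampled with replacement from a finite centred
population. -/
theorem norm_sum_sampling {𝕜 E α : Type*} [RCLike 𝕜] [NormedAddCommGroup E]
    [InnerProductSpace 𝕜 E] [Fintype α] (z : α → E) (hz : ∑ j, z j = 0) {lam v r : ℝ}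
    (hlam : 0 ≤ lam) (hz1 : ∀ j, lam * ‖z j‖ ≤ 1) (hv : ∑ j, ‖z j‖ ^ 2 ≤ Fintype.card α * v)
    (m : ℕ) (A : Finset (Fin m → α)) (hA : ∀ s ∈ A, r ≤ ‖∑ i, z (s i)‖) :
    A.card ≤ (Fintype.card α : ℝ) ^ m * (2 * Real.exp (3 / 4 * (m * lam ^ 2 * v) - lam * r)) := by
  have hn : ∀ y : E, ‖(lam : 𝕜) • y‖ = lam * ‖y‖ := fun y => by
    rw [norm_smul, RCLike.norm_ofReal, abs_of_nonneg hlam]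
  have key := card_paths_mul_le (fun s : E => Real.cosh ‖s‖) (fun _ => True)
    (fun j => (lam : 𝕜) • z j)
    (B := Fintype.card α * Real.exp (3 / 4 * (lam ^ 2 * v))) (by positivity)
    (fun _ _ _ => trivial) trivial
    (fun s _ => by
      obtain ⟨κ, hκ⟩ := exists_cosh_norm_add_le (𝕜 := 𝕜) s
      calc ∑ j, Real.cosh ‖s + (lam : 𝕜) • z j‖
          ≤ ∑ j, (Real.cosh ‖s‖ * (1 + 3 / 4 * (lam ^ 2 * ‖z j‖ ^ 2)) +
              κ * RCLike.re (inner 𝕜 s ((lam : 𝕜) • z j))) := by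
            refine Finset.sum_le_sum fun j _ => (hκ _).trans ?_
            have hcp := (Real.cosh_pos ‖s‖).le
            gcongr
            -- With `Y` = 1 the coefficient 1/(2(1 - Y/3)) is the 3/4 of the exponent.
            have := exp_le_one_add_add_sq_div (y := ‖(lam : 𝕜) • z j‖) (Y := 1)
              (by rw [hn]; exact hz1 j) (by norm_num)
            rw [hn] at this ⊢
            norm_num at this
            linarith
        _ = Real.cosh ‖s‖ * (Fintype.card α + 3 / 4 * (lam ^ 2 * ∑ j, ‖z j‖ ^ 2)) := by
            rw [Finset.sum_add_distrib, ← Finset.mul_sum, ← Finset.mul_sum, ← map_sum, ← inner_sum,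
              ← Finset.smul_sum, hz, Finset.sum_add_distrib, ← Finset.mul_sum, ← Finset.mul_sum]
            simp
        _ ≤ Real.cosh ‖s‖ * (Fintype.card α + 3 / 4 * (lam ^ 2 * (Fintype.card α * v))) := by
            have := (Real.cosh_pos ‖s‖).le
            gcongr
        _ = Fintype.card α * (3 / 4 * (lam ^ 2 * v) + 1) * Real.cosh ‖s‖ := by ring
        _ ≤ _ := by
            have := (Real.cosh_pos ‖s‖).le
            gcongr
            exact Real.add_one_le_exp _) m (fun s _ => (Real.cosh_pos _).le)
    -- The factor 2 in the conclusion comes from cosh u ≥ eᵘ/2.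
    (Real.exp (lam * r) / 2) A
    (fun s hs => by
      have h1 := hA s hs
      rw [← Finset.smul_sum, hn, Real.cosh_eq]
      have h2 : Real.exp (lam * r) ≤ Real.exp (lam * ‖∑ i, z (s i)‖) := by gcongr
      have h3 := Real.exp_pos (-(lam * ‖∑ i, z (s i)‖))
      linarith)
  simp only [norm_zero, Real.cosh_zero, mul_one] at key
  rw [mul_pow, ← Real.exp_nat_mul] at key
  have h4 : (Fintype.card α : ℝ) ^ m * (2 * Real.exp (3 / 4 * (m * lam ^ 2 * v) - lam * r)) =
    (Fintype.card α : ℝ) ^ m * Real.exp (m * (3 / 4 * (lam ^ 2 * v))) / (Real.exp (lam * r) / 2) := by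
    rw [Real.exp_sub]; field_simp
  rw [h4, le_div_iff₀ (by positivity)]
  exact key

/-! ### Quadratic forms and functional calculus of Hermitian matrices -/

open Matrix

section MatrixForms

variable {𝕜 ι : Type*} [RCLike 𝕜]

theorem isHermitian_vecMulVec_star (q : ι → 𝕜) : (vecMulVec q (star q)).IsHermitian := by
  rw [IsHermitian, conjTranspose_vecMulVec, star_star]

variable [Fintype ι]

/-- The squared Euclidean norm of a vector. -/
def sqNorm (v : ι → 𝕜) : ℝ := ∑ i, ‖v i‖ ^ 2

/-- The real part of the quadratic form of a matrix. -/
def quadForm (A : Matrix ι ι 𝕜) (v : ι → 𝕜) : ℝ := RCLike.re (star v ⬝ᵥ A *ᵥ v)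

theorem sqNorm_nonneg (v : ι → 𝕜) : 0 ≤ sqNorm v := by unfold sqNorm; positivity

theorem star_dotProduct_self (v : ι → 𝕜) : star v ⬝ᵥ v = (sqNorm v : 𝕜) := by
  simp [dotProduct, sqNorm, RCLike.conj_mul]

theorem sqNorm_eq_re (v : ι → 𝕜) : sqNorm v = RCLike.re (star v ⬝ᵥ v) := by
  rw [star_dotProduct_self, RCLike.ofReal_re]

theorem quadForm_add (A B : Matrix ι ι 𝕜) (v : ι → 𝕜) :
    quadForm (A + B) v = quadForm A v + quadForm B v := by
  simp [quadForm, add_mulVec, dotProduct_add]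

theorem quadForm_sum {κ : Type*} (s : Finset κ) (A : κ → Matrix ι ι 𝕜) (v : ι → 𝕜) :
    quadForm (∑ i ∈ s, A i) v = ∑ i ∈ s, quadForm (A i) v := by
  simp [quadForm, sum_mulVec, dotProduct_sum]

theorem quadForm_smul (c : ℝ) (A : Matrix ι ι 𝕜) (v : ι → 𝕜) :
    quadForm ((c : 𝕜) • A) v = c * quadForm A v := by
  rw [quadForm, smul_mulVec, dotProduct_smul, smul_eq_mul, RCLike.re_ofReal_mul, quadForm]

theorem quadForm_vecMulVec (q v : ι → 𝕜) :
    quadForm (vecMulVec q (star q)) v = ‖star q ⬝ᵥ v‖ ^ 2 := by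
  have h : star v ⬝ᵥ q = star (star q ⬝ᵥ v) := star_dotProduct _ _
  rw [quadForm, vecMulVec_mulVec, dotProduct_smul, h]
  simp [RCLike.conj_mul]

/-- A rank-one middle factor splits the form at its own vector; as `A` is Hermitian the first factor
is real, so the real part is multiplicative. -/
theorem quadForm_mul_vecMulVec_mul {A : Matrix ι ι 𝕜} (hA : A.IsHermitian) (B : Matrix ι ι 𝕜)
    (q : ι → 𝕜) :
    quadForm (A * vecMulVec q (star q) * B) q = quadForm A q * quadForm B q := by
  have h : RCLike.im (star q ⬝ᵥ A *ᵥ q) = 0 := hA.im_star_dotProduct_mulVec_self q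
  have h2 : star q ⬝ᵥ (A * vecMulVec q (star q) * B) *ᵥ q =
      (star q ⬝ᵥ A *ᵥ q) * (star q ⬝ᵥ B *ᵥ q) := by
    rw [mul_assoc, ← mulVec_mulVec, ← mulVec_mulVec, vecMulVec_mulVec]
    simp [mulVec_smul, mul_comm]
  rw [quadForm, h2, RCLike.mul_re, h]
  simp [quadForm]

variable [DecidableEq ι]

theorem quadForm_unitary_conj_diagonal (U : Matrix ι ι 𝕜) (f : ι → ℝ) (v : ι → 𝕜) :
    quadForm (U * diagonal (fun i => (f i : 𝕜)) * Uᴴ) v = ∑ i, ‖(Uᴴ *ᵥ v) i‖ ^ 2 * f i := by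
  have h : star v ⬝ᵥ (U * diagonal (fun i => (f i : 𝕜)) * Uᴴ) *ᵥ v =
      star (Uᴴ *ᵥ v) ⬝ᵥ diagonal (fun i => (f i : 𝕜)) *ᵥ (Uᴴ *ᵥ v) := by
    rw [star_mulVec, conjTranspose_conjTranspose, ← dotProduct_mulVec, mulVec_mulVec, mulVec_mulVec]
  rw [quadForm, h, dotProduct, map_sum]
  refine Finset.sum_congr rfl fun i _ => ?_
  rw [mulVec_diagonal, Pi.star_apply, ← mul_assoc, mul_comm, ← mul_assoc, RCLike.star_def,
    RCLike.mul_conj]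
  norm_cast

theorem sqNorm_conjTranspose_mulVec {U : Matrix ι ι 𝕜} (hU : U * Uᴴ = 1) (v : ι → 𝕜) :
    sqNorm (Uᴴ *ᵥ v) = sqNorm v := by
  rw [sqNorm_eq_re, sqNorm_eq_re, star_mulVec, conjTranspose_conjTranspose, ← dotProduct_mulVec,
    mulVec_mulVec, hU, one_mulVec]

/-- A unitary diagonalization of a Hermitian matrix. -/
theorem exists_diagonalization {A : Matrix ι ι 𝕜} (hA : A.IsHermitian) :
    ∃ (U : Matrix ι ι 𝕜) (a : ι → ℝ), Uᴴ * U = 1 ∧ U * Uᴴ = 1 ∧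
      A = U * diagonal (fun i => (a i : 𝕜)) * Uᴴ := by
  refine ⟨hA.eigenvectorUnitary, hA.eigenvalues, ?_, ?_, ?_⟩
  · exact (Unitary.mem_iff.1 hA.eigenvectorUnitary.2).1
  · exact (Unitary.mem_iff.1 hA.eigenvectorUnitary.2).2
  · conv_lhs => rw [hA.spectral_theorem, Unitary.conjStarAlgAut_apply]
    rfl

theorem pow_unitary_conj_diagonal {U : Matrix ι ι 𝕜} (hU : Uᴴ * U = 1) (hU' : U * Uᴴ = 1)
    (a : ι → ℝ) (n : ℕ) :
    (U * diagonal (fun i => (a i : 𝕜)) * Uᴴ) ^ n =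
      U * diagonal (fun i => ((a i ^ n : ℝ) : 𝕜)) * Uᴴ := by
  induction n with
  | zero => simp [hU']
  | succ n ih =>
    rw [pow_succ, ih]
    calc _ = U * diagonal (fun i => ((a i ^ n : ℝ) : 𝕜)) * (Uᴴ * U) *
          diagonal (fun i => (a i : 𝕜)) * Uᴴ := by simp only [mul_assoc]
      _ = _ := by
        rw [hU, mul_one, mul_assoc U, diagonal_mul_diagonal]
        simp [pow_succ]

theorem exp_unitary_conj_diagonal {U : Matrix ι ι 𝕜} (hU : Uᴴ * U = 1) (hU' : U * Uᴴ = 1)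
    (a : ι → ℝ) :
    NormedSpace.exp (U * diagonal (fun i => (a i : 𝕜)) * Uᴴ) =
      U * diagonal (fun i => ((Real.exp (a i) : ℝ) : 𝕜)) * Uᴴ := by
  have hinv : U⁻¹ = Uᴴ := inv_eq_left_inv hU
  have hun : IsUnit U := IsUnit.of_mul_eq_one _ hU'
  rw [← hinv, exp_conj _ _ hun, exp_diagonal]
  congr 3
  funext i
  rw [Pi.coe_exp, Real.exp_eq_exp_ℝ]
  exact (NormedSpace.algebraMap_exp_comm (𝔸 := 𝕜) (a i)).symm

theorem trace_unitary_conj {U : Matrix ι ι 𝕜} (hU : Uᴴ * U = 1) (D : Matrix ι ι 𝕜) :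
    (U * D * Uᴴ).trace = D.trace := by
  rw [trace_mul_comm, ← mul_assoc, hU, one_mul]

theorem re_trace_exp_unitary_conj_diagonal {U : Matrix ι ι 𝕜} (hU : Uᴴ * U = 1)
    (hU' : U * Uᴴ = 1) (a : ι → ℝ) :
    RCLike.re (NormedSpace.exp (U * diagonal (fun i => (a i : 𝕜)) * Uᴴ)).trace =
      ∑ i, Real.exp (a i) := by
  rw [exp_unitary_conj_diagonal hU hU', trace_unitary_conj hU, trace_diagonal]
  simp

theorem hasSum_quadForm_exp {A : Matrix ι ι 𝕜} (hA : A.IsHermitian) (q : ι → 𝕜) :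
    HasSum (fun n : ℕ => quadForm (A ^ n) q / n.factorial) (quadForm (NormedSpace.exp A) q) := by
  obtain ⟨U, a, hU, hU', rfl⟩ := exists_diagonalization hA
  rw [exp_unitary_conj_diagonal hU hU', quadForm_unitary_conj_diagonal]
  simp only [pow_unitary_conj_diagonal hU hU', quadForm_unitary_conj_diagonal, Finset.sum_div]
  refine hasSum_sum fun i _ => ?_
  have := (NormedSpace.expSeries_div_hasSum_exp (𝔸 := ℝ) (a i)).mul_left (‖(Uᴴ *ᵥ q) i‖ ^ 2)
  rw [← Real.exp_eq_exp_ℝ] at this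
  simpa only [mul_div_assoc] using this

theorem quadForm_exp_nonneg {A : Matrix ι ι 𝕜} (hA : A.IsHermitian) (q : ι → 𝕜) :
    0 ≤ quadForm (NormedSpace.exp A) q := by
  obtain ⟨U, a, hU, hU', rfl⟩ := exists_diagonalization hA
  rw [exp_unitary_conj_diagonal hU hU', quadForm_unitary_conj_diagonal]
  positivity

theorem re_trace_exp_nonneg {A : Matrix ι ι 𝕜} (hA : A.IsHermitian) :
    0 ≤ RCLike.re (NormedSpace.exp A).trace := by
  obtain ⟨U, a, hU, hU', rfl⟩ := exists_diagonalization hA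
  rw [re_trace_exp_unitary_conj_diagonal hU hU']
  positivity

/-- A bound for the trace of the exponential bounds the quadratic form. -/
theorem quadForm_le_of_re_trace_exp_le {A : Matrix ι ι 𝕜} (hA : A.IsHermitian) {τ : ℝ}
    (h : RCLike.re (NormedSpace.exp A).trace ≤ Real.exp τ) (v : ι → 𝕜) :
    quadForm A v ≤ τ * sqNorm v := by
  obtain ⟨U, a, hU, hU', rfl⟩ := exists_diagonalization hA
  rw [re_trace_exp_unitary_conj_diagonal hU hU'] at h
  rw [quadForm_unitary_conj_diagonal, ← sqNorm_conjTranspose_mulVec hU' v, sqNorm,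
    Finset.mul_sum]
  refine Finset.sum_le_sum fun i _ => ?_
  have : Real.exp (a i) ≤ Real.exp τ :=
    (Finset.single_le_sum (f := fun i => Real.exp (a i)) (fun i _ => (Real.exp_pos _).le)
      (Finset.mem_univ i)).trans h
  rw [mul_comm τ]
  gcongr
  exact Real.exp_le_exp.1 this

/-- Jensen's inequality for the exponential of a Hermitian matrix. -/
theorem exp_quadForm_le {A : Matrix ι ι 𝕜} (hA : A.IsHermitian) {v : ι → 𝕜} (hv : sqNorm v = 1) :
    Real.exp (quadForm A v) ≤ quadForm (NormedSpace.exp A) v := by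
  obtain ⟨U, a, hU, hU', rfl⟩ := exists_diagonalization hA
  rw [exp_unitary_conj_diagonal hU hU', quadForm_unitary_conj_diagonal,
    quadForm_unitary_conj_diagonal]
  have hw : ∑ i, ‖(Uᴴ *ᵥ v) i‖ ^ 2 = 1 := by
    rw [← hv, ← sqNorm_conjTranspose_mulVec hU' v, sqNorm]
  simpa using convexOn_exp.map_sum_le (t := Finset.univ) (w := fun i => ‖(Uᴴ *ᵥ v) i‖ ^ 2) (p := a)
    (fun i _ => by positivity) hw (fun i _ => Set.mem_univ _)

/-! ### Trace exponentials under rank-one perturbations, matrix Chernoff -/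

theorem trace_eq_sum_dotProduct_col {U : Matrix ι ι 𝕜} (hU' : U * Uᴴ = 1) (A : Matrix ι ι 𝕜) :
    A.trace = ∑ l, star (Uᵀ l) ⬝ᵥ A *ᵥ Uᵀ l := by
  have : A.trace = (Uᴴ * A * U).trace := by
    rw [trace_mul_comm, ← mul_assoc, hU', one_mul]
  rw [this, trace]
  refine Finset.sum_congr rfl fun l _ => ?_
  rw [diag_apply, mul_assoc, mul_apply]
  simp only [dotProduct, mulVec, mul_apply, conjTranspose_apply, Pi.star_apply, transpose_apply]

theorem conjTranspose_mulVec_col {U : Matrix ι ι 𝕜} (hU : Uᴴ * U = 1) (l : ι) :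
    Uᴴ *ᵥ Uᵀ l = Pi.single l 1 := by
  funext i
  have := congrFun (congrFun hU i) l
  rw [mul_apply] at this
  simp only [mulVec, dotProduct, transpose_apply, this, one_apply, Pi.single_apply]

theorem quadForm_col {U : Matrix ι ι 𝕜} (hU : Uᴴ * U = 1) (a : ι → ℝ) (l : ι) :
    quadForm (U * diagonal (fun i => (a i : 𝕜)) * Uᴴ) (Uᵀ l) = a l := by
  rw [quadForm_unitary_conj_diagonal, conjTranspose_mulVec_col hU, Finset.sum_eq_single l] <;>
    simp +contextual

/-- Peierls' inequality for a rank-one perturbation. -/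
theorem re_trace_exp_add_le {K : Matrix ι ι 𝕜} (hK : K.IsHermitian) (q : ι → 𝕜) (t : ℝ) :
    RCLike.re (NormedSpace.exp K).trace + t * quadForm (NormedSpace.exp K) q ≤
      RCLike.re (NormedSpace.exp (K + (t : 𝕜) • vecMulVec q (star q))).trace := by
  have hN : (K + (t : 𝕜) • vecMulVec q (star q)).IsHermitian :=
    hK.add ((isHermitian_vecMulVec_star q).smul (by simp [IsSelfAdjoint]))
  obtain ⟨U, a, hU, hU', hKU⟩ := exists_diagonalization hK
  rw [trace_eq_sum_dotProduct_col hU' (NormedSpace.exp (K + _)), map_sum]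
  -- In the eigenbasis of `K`, Jensen bounds each diagonal entry of the perturbed exponential below
  -- by the exponential of the diagonal entry; then 1 + x ≤ eˣ.
  have hl : ∀ l, Real.exp (a l) + t * (‖(Uᴴ *ᵥ q) l‖ ^ 2 * Real.exp (a l)) ≤
      RCLike.re (star (Uᵀ l) ⬝ᵥ NormedSpace.exp (K + (t : 𝕜) • vecMulVec q (star q)) *ᵥ Uᵀ l) := by
    intro l
    have h1 : sqNorm (Uᵀ l) = 1 := by
      rw [← sqNorm_conjTranspose_mulVec hU', conjTranspose_mulVec_col hU, sqNorm,
        Finset.sum_eq_single l] <;> simp +contextual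
    refine le_trans ?_ (exp_quadForm_le hN h1)
    have h2 : quadForm K (Uᵀ l) = a l := by rw [hKU, quadForm_col hU]
    have h3 : ‖star q ⬝ᵥ Uᵀ l‖ = ‖(Uᴴ *ᵥ q) l‖ := by
      have : star q ⬝ᵥ Uᵀ l = star ((Uᴴ *ᵥ q) l) := by
        simp [mulVec, dotProduct, mul_comm]
      rw [this, norm_star]
    rw [quadForm_add, quadForm_smul, quadForm_vecMulVec, h2, h3, Real.exp_add]
    nlinarith [Real.add_one_le_exp (t * ‖(Uᴴ *ᵥ q) l‖ ^ 2), Real.exp_pos (a l)]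
  refine le_trans (le_of_eq ?_) (Finset.sum_le_sum fun l _ => hl l)
  rw [hKU, re_trace_exp_unitary_conj_diagonal hU hU', exp_unitary_conj_diagonal hU hU',
    quadForm_unitary_conj_diagonal, Finset.sum_add_distrib, Finset.mul_sum]

theorem unitary_conj_diagonal_add_smul_one {U : Matrix ι ι 𝕜} (hU' : U * Uᴴ = 1) (a : ι → ℝ)
    (c : ℝ) :
    U * diagonal (fun i => (a i : 𝕜)) * Uᴴ + (c : 𝕜) • 1 =
      U * diagonal (fun i => ((a i + c : ℝ) : 𝕜)) * Uᴴ := by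
  have h : diagonal (fun i => ((a i + c : ℝ) : 𝕜)) =
      diagonal (fun i => (a i : 𝕜)) + (c : 𝕜) • (1 : Matrix ι ι 𝕜) := by
    rw [smul_one_eq_diagonal, diagonal_add]
    simp
  rw [h, mul_add, add_mul, Matrix.mul_smul, mul_one, Matrix.smul_mul, hU']

theorem exp_add_smul_one {A : Matrix ι ι 𝕜} (hA : A.IsHermitian) (c : ℝ) :
    NormedSpace.exp (A + (c : 𝕜) • 1) = ((Real.exp c : ℝ) : 𝕜) • NormedSpace.exp A := by
  obtain ⟨U, a, hU, hU', rfl⟩ := exists_diagonalization hA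
  have h : diagonal (fun i => ((Real.exp (a i + c) : ℝ) : 𝕜)) =
      ((Real.exp c : ℝ) : 𝕜) • diagonal (fun i => ((Real.exp (a i) : ℝ) : 𝕜)) := by
    rw [← diagonal_smul]
    congr 1
    funext i
    simp only [Pi.smul_apply, smul_eq_mul]
    rw [← RCLike.ofReal_mul, ← Real.exp_add, add_comm]
  rw [unitary_conj_diagonal_add_smul_one hU', exp_unitary_conj_diagonal hU hU',
    exp_unitary_conj_diagonal hU hU', h, Matrix.mul_smul, Matrix.smul_mul]

/-- Chebyshev's inequality for the spectral measure of a vector. -/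
theorem quadForm_pow_mul_le {K : Matrix ι ι 𝕜} (hK : K.IsHermitian)
    (hK0 : ∀ v, 0 ≤ quadForm K v) {c : ℝ} (hc : 0 ≤ c) (q : ι → 𝕜) (m n : ℕ) :
    quadForm (K ^ m) q * quadForm ((K + (c : 𝕜) • 1) ^ n) q ≤
      sqNorm q * quadForm (K ^ m * (K + (c : 𝕜) • 1) ^ n) q := by
  obtain ⟨U, a, hU, hU', rfl⟩ := exists_diagonalization hK
  have ha : ∀ l, 0 ≤ a l := fun l => quadForm_col hU a l ▸ hK0 (Uᵀ l)
  have hprod : U * diagonal (fun i => ((a i ^ m : ℝ) : 𝕜)) * Uᴴ *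
      (U * diagonal (fun i => (((a i + c) ^ n : ℝ) : 𝕜)) * Uᴴ) =
      U * diagonal (fun i => ((a i ^ m * (a i + c) ^ n : ℝ) : 𝕜)) * Uᴴ := by
    calc _ = U * diagonal (fun i => ((a i ^ m : ℝ) : 𝕜)) * (Uᴴ * U) *
          diagonal (fun i => (((a i + c) ^ n : ℝ) : 𝕜)) * Uᴴ := by simp only [mul_assoc]
      _ = _ := by
        rw [hU, mul_one, mul_assoc U, diagonal_mul_diagonal]
        simp
  rw [unitary_conj_diagonal_add_smul_one hU', pow_unitary_conj_diagonal hU hU',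
    pow_unitary_conj_diagonal hU hU', hprod]
  simp only [quadForm_unitary_conj_diagonal]
  rw [← sqNorm_conjTranspose_mulVec hU' q, sqNorm]
  set w : ι → ℝ := fun i => ‖(Uᴴ *ᵥ q) i‖ ^ 2
  have hw : ∀ i, 0 ≤ w i := fun i => by positivity
  -- Both x ↦ xᵐ and x ↦ (x + c)ⁿ increase on [0, ∞), so each term of the symmetrized sum is
  -- nonnegative; the sum is twice the difference of the two sides.
  have key : 0 ≤ ∑ i, ∑ j, w i * w j * ((a i ^ m - a j ^ m) * ((a i + c) ^ n - (a j + c) ^ n)) := by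
    refine Finset.sum_nonneg fun i _ => Finset.sum_nonneg fun j _ =>
      mul_nonneg (mul_nonneg (hw i) (hw j)) ?_
    rcases le_total (a i) (a j) with h | h
    · refine mul_nonneg_of_nonpos_of_nonpos (sub_nonpos.2 ?_) (sub_nonpos.2 ?_)
      · exact pow_le_pow_left₀ (ha i) h m
      · exact pow_le_pow_left₀ (by linarith [ha i]) (by linarith) n
    · refine mul_nonneg (sub_nonneg.2 ?_) (sub_nonneg.2 ?_)
      · exact pow_le_pow_left₀ (ha j) h m
      · exact pow_le_pow_left₀ (by linarith [ha j]) (by linarith) n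
  have hexp : ∑ i, ∑ j, w i * w j * ((a i ^ m - a j ^ m) * ((a i + c) ^ n - (a j + c) ^ n)) =
      2 * ((∑ i, w i) * ∑ i, w i * (a i ^ m * (a i + c) ^ n) -
        (∑ i, w i * a i ^ m) * ∑ i, w i * (a i + c) ^ n) := by
    have h1 : ∀ i j, w i * w j * ((a i ^ m - a j ^ m) * ((a i + c) ^ n - (a j + c) ^ n)) =
        (w i * (a i ^ m * (a i + c) ^ n)) * w j + w i * (w j * (a j ^ m * (a j + c) ^ n)) -
        (w i * a i ^ m) * (w j * (a j + c) ^ n) - (w i * (a i + c) ^ n) * (w j * a j ^ m) := by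
      intro i j; ring
    simp only [h1, Finset.sum_sub_distrib, Finset.sum_add_distrib, ← Finset.mul_sum,
      ← Finset.sum_mul]
    ring
  change (∑ i, w i * a i ^ m) * (∑ i, w i * (a i + c) ^ n) ≤
    (∑ i, w i) * ∑ i, w i * (a i ^ m * (a i + c) ^ n)
  linarith

theorem quadForm_pow_nonneg {K : Matrix ι ι 𝕜} (hK : K.IsHermitian)
    (hK0 : ∀ v, 0 ≤ quadForm K v) (q : ι → 𝕜) (m : ℕ) : 0 ≤ quadForm (K ^ m) q := by
  obtain ⟨U, a, hU, hU', rfl⟩ := exists_diagonalization hK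
  have ha : ∀ l, 0 ≤ a l := fun l => quadForm_col hU a l ▸ hK0 (Uᵀ l)
  rw [pow_unitary_conj_diagonal hU hU', quadForm_unitary_conj_diagonal]
  exact Finset.sum_nonneg fun i _ => mul_nonneg (by positivity) (pow_nonneg (ha i) m)

/-- Peel one perturbed factor off next to Kᵐ. Its `K` part raises m, hence the induction with m
general; its rank-one part splits into a product of two forms, which `quadForm_pow_mul_le` merges at
the price of ‖q‖². -/
theorem quadForm_pow_mul_pow_le {K : Matrix ι ι 𝕜} (hK : K.IsHermitian)
    (hK0 : ∀ v, 0 ≤ quadForm K v) {t : ℝ} (ht : 0 ≤ t) (q : ι → 𝕜) (m n : ℕ) :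
    quadForm (K ^ m * (K + (t : 𝕜) • vecMulVec q (star q)) ^ n) q ≤
      quadForm (K ^ m * (K + ((t * sqNorm q : ℝ) : 𝕜) • 1) ^ n) q := by
  induction n generalizing m with
  | zero => simp
  | succ n ih =>
    set N := K + (t : 𝕜) • vecMulVec q (star q)
    set C := K + ((t * sqNorm q : ℝ) : 𝕜) • (1 : Matrix ι ι 𝕜)
    have h1 : K ^ m * N ^ (n + 1) = K ^ (m + 1) * N ^ n +
        (t : 𝕜) • (K ^ m * vecMulVec q (star q) * N ^ n) := by
      rw [pow_succ' N, pow_succ K, ← mul_assoc (K ^ m)]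
      simp only [N, mul_add, add_mul, Matrix.mul_smul, Matrix.smul_mul]
    have h2 : K ^ m * C ^ (n + 1) = K ^ (m + 1) * C ^ n +
        ((t * sqNorm q : ℝ) : 𝕜) • (K ^ m * C ^ n) := by
      rw [pow_succ' C, pow_succ K, ← mul_assoc (K ^ m)]
      simp only [C, mul_add, add_mul, Matrix.mul_smul, Matrix.smul_mul, mul_one]
    rw [h1, h2, quadForm_add, quadForm_add, quadForm_smul, quadForm_smul,
      quadForm_mul_vecMulVec_mul (hK.pow m)]
    have h3 := ih (m + 1)
    have h4 := ih 0
    simp only [pow_zero, one_mul] at h4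
    have h5 := quadForm_pow_mul_le hK hK0 (mul_nonneg ht (sqNorm_nonneg q)) q m n
    have h6 := mul_le_mul_of_nonneg_left h4 (quadForm_pow_nonneg hK hK0 q m)
    have h7 := mul_le_mul_of_nonneg_left (h6.trans h5) ht
    linarith

/-- Tested on q itself, t q qᴴ counts for no more than the scalar t‖q‖². The exponential series are
compared termwise after a scalar shift makes `K` positive semidefinite; the shift multiplies both
sides by eᶜ. -/
theorem quadForm_exp_add_le {K : Matrix ι ι 𝕜} (hK : K.IsHermitian) {t : ℝ} (ht : 0 ≤ t)
    (q : ι → 𝕜) :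
    quadForm (NormedSpace.exp (K + (t : 𝕜) • vecMulVec q (star q))) q ≤
      Real.exp (t * sqNorm q) * quadForm (NormedSpace.exp K) q := by
  obtain ⟨c, hc⟩ : ∃ c : ℝ, ∀ v, 0 ≤ quadForm (K + (c : 𝕜) • 1) v := by
    obtain ⟨U, a, hU, hU', rfl⟩ := exists_diagonalization hK
    refine ⟨∑ i, |a i|, fun v => ?_⟩
    rw [unitary_conj_diagonal_add_smul_one hU', quadForm_unitary_conj_diagonal]
    refine Finset.sum_nonneg fun i _ => mul_nonneg (by positivity) ?_
    have := Finset.single_le_sum (f := fun i => |a i|) (fun _ _ => abs_nonneg _)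
      (Finset.mem_univ i)
    have h2 := neg_abs_le (a i)
    linarith
  have hsm : ∀ (c : ℝ), ((c : 𝕜) • (1 : Matrix ι ι 𝕜)).IsHermitian := fun c =>
    isHermitian_one.smul (by simp [IsSelfAdjoint])
  have hP : ((t : 𝕜) • vecMulVec q (star q)).IsHermitian :=
    (isHermitian_vecMulVec_star q).smul (by simp [IsSelfAdjoint])
  set K' := K + (c : 𝕜) • (1 : Matrix ι ι 𝕜)
  have hK' : K'.IsHermitian := hK.add (hsm c)
  have key : quadForm (NormedSpace.exp (K' + (t : 𝕜) • vecMulVec q (star q))) q ≤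
      quadForm (NormedSpace.exp (K' + ((t * sqNorm q : ℝ) : 𝕜) • 1)) q := by
    refine hasSum_le (fun n => ?_) (hasSum_quadForm_exp (hK'.add hP) q)
      (hasSum_quadForm_exp (hK'.add (hsm _)) q)
    have := quadForm_pow_mul_pow_le hK' hc ht q 0 n
    simp only [pow_zero, one_mul] at this
    gcongr
  rw [show K' + (t : 𝕜) • vecMulVec q (star q) = K + (t : 𝕜) • vecMulVec q (star q) + (c : 𝕜) • 1
    from add_right_comm _ _ _, exp_add_smul_one (hK.add hP), exp_add_smul_one hK',
    exp_add_smul_one hK, quadForm_smul, quadForm_smul, quadForm_smul] at key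
  have := Real.exp_pos c
  nlinarith

/-- A one-step bound in the manner of the Golden–Thompson inequality for the removal of a rank-one
matrix. -/
theorem re_trace_exp_sub_le {M : Matrix ι ι 𝕜} (hM : M.IsHermitian) {θ : ℝ} (hθ : 0 ≤ θ)
    (q : ι → 𝕜) :
    RCLike.re (NormedSpace.exp (M + ((-θ : ℝ) : 𝕜) • vecMulVec q (star q))).trace ≤
      RCLike.re (NormedSpace.exp M).trace -
        (θ - 2 / 3 * sqNorm q * θ ^ 2) * quadForm (NormedSpace.exp M) q := by
  set P := vecMulVec q (star q)
  have hP : ∀ t : ℝ, (M + (t : 𝕜) • P).IsHermitian := fun t =>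
    hM.add ((isHermitian_vecMulVec_star q).smul (by simp [IsSelfAdjoint]))
  have hadd : ∀ s t : ℝ, M + (s : 𝕜) • P + (t : 𝕜) • P = M + ((s + t : ℝ) : 𝕜) • P := fun s t => by
    rw [RCLike.ofReal_add, add_smul, add_assoc]
  have hg := quadForm_exp_nonneg hM q
  -- The removal is done in three parts of size θ/3. In each, Peierls is applied at the far end, and
  -- the exponential there is compared with that of `M`. The losses add up to (1 + 2 + 3)/9 = 2/3
  -- times ‖q‖²θ².
  have step : ∀ s : ℝ, 0 ≤ s →
      RCLike.re (NormedSpace.exp (M + ((-(s + θ / 3) : ℝ) : 𝕜) • P)).trace +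
        θ / 3 * ((1 - (s + θ / 3) * sqNorm q) * quadForm (NormedSpace.exp M) q) ≤
      RCLike.re (NormedSpace.exp (M + ((-s : ℝ) : 𝕜) • P)).trace := by
    intro s hs
    have h1 := re_trace_exp_add_le (hP (-(s + θ / 3))) q (θ / 3)
    have h2 := quadForm_exp_add_le (hP (-(s + θ / 3))) (t := s + θ / 3) (by positivity) q
    rw [hadd] at h1 h2
    rw [show -(s + θ / 3) + θ / 3 = -s by ring] at h1
    rw [show -(s + θ / 3) + (s + θ / 3) = 0 by ring, RCLike.ofReal_zero, zero_smul, add_zero] at h2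
    refine le_trans ?_ h1
    have h3 := Real.add_one_le_exp (-((s + θ / 3) * sqNorm q))
    have h4 : Real.exp (-((s + θ / 3) * sqNorm q)) * quadForm (NormedSpace.exp M) q ≤
        quadForm (NormedSpace.exp (M + ((-(s + θ / 3) : ℝ) : 𝕜) • P)) q := by
      rw [Real.exp_neg, inv_mul_le_iff₀ (Real.exp_pos _)]
      exact h2
    have h5 := mul_le_mul_of_nonneg_right h3 hg
    gcongr
    linarith
  have s0 := step 0 le_rfl
  have s1 := step (θ / 3) (by positivity)
  have s2 := step (θ / 3 + θ / 3) (by positivity)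
  simp only [neg_zero, RCLike.ofReal_zero, zero_smul, add_zero, zero_add] at s0
  rw [show θ / 3 + θ / 3 + θ / 3 = θ by ring] at s2
  linarith

/-- The lower tail of the matrix Chernoff inequality for rank-one matrices sampled with
replacement. -/
theorem matrix_chernoff_sampling {α : Type*} [Fintype α] (q : α → ι → 𝕜)
    (hq : ∑ j, vecMulVec (q j) (star (q j)) = 1) {R γ : ℝ} (hR : 0 < R)
    (hqR : ∀ j, sqNorm (q j) ≤ R) (hγ : 0 < γ) (m : ℕ) (A : Finset (Fin m → α))
    (hA : ∀ s ∈ A, ∃ v, ∑ i, ‖star (q (s i)) ⬝ᵥ v‖ ^ 2 <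
      (1 - γ) * m / Fintype.card α * sqNorm v) :
    A.card ≤ (Fintype.card α : ℝ) ^ m *
      (Fintype.card ι * Real.exp (-(3 / 8 * γ ^ 2 * m / (Fintype.card α * R)))) := by
  rcases A.eq_empty_or_nonempty with rfl | ⟨s₀, hs₀⟩
  · simp; positivity
  have hm : 0 < m := by
    rcases Nat.eq_zero_or_pos m with rfl | h
    · obtain ⟨v, hv⟩ := hA _ hs₀
      simp at hv
    · exact h
  have hcard : 0 < Fintype.card α := Fintype.card_pos_iff.2 ⟨s₀ ⟨0, hm⟩⟩
  have hc' : (0 : ℝ) < Fintype.card α := by exact_mod_cast hcard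
  set n : ℝ := (Fintype.card α : ℝ)
  -- Minimizes (2/3)Rθ² - γθ; the minimum -3γ²/(8R) gives the constant 3/8.
  set θ : ℝ := 3 * γ / (4 * R) with hθ
  have hθ0 : 0 < θ := by positivity
  set η : ℝ := θ - 2 / 3 * R * θ ^ 2 with hη
  have hherm : ∀ j, (((-θ : ℝ) : 𝕜) • vecMulVec (q j) (star (q j))).IsHermitian := fun j =>
    (isHermitian_vecMulVec_star (q j)).smul (by simp [IsSelfAdjoint])
  have key := card_paths_mul_le (fun M : Matrix ι ι 𝕜 => RCLike.re (NormedSpace.exp M).trace)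
    (fun M => M.IsHermitian) (fun j => ((-θ : ℝ) : 𝕜) • vecMulVec (q j) (star (q j)))
    (B := n * Real.exp (-(η / n))) (by positivity)
    (fun M j hM => hM.add (hherm j)) isHermitian_zero
    (fun M hM => by
      have hg := fun j => quadForm_exp_nonneg hM (q j)
      -- As the population sums to the identity, the average decrease is a fixed proportion of the
      -- trace.
      have htr : ∑ j, quadForm (NormedSpace.exp M) (q j) = RCLike.re (NormedSpace.exp M).trace := by
        have h1 : ∀ j, quadForm (NormedSpace.exp M) (q j) =
            RCLike.re (NormedSpace.exp M * vecMulVec (q j) (star (q j))).trace := by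
          intro j
          rw [mul_vecMulVec, trace_vecMulVec, dotProduct_comm, quadForm]
        simp only [h1]
        rw [← map_sum, ← trace_sum, ← Finset.mul_sum, hq, mul_one]
      have hF := re_trace_exp_nonneg hM
      calc _ ≤ ∑ j, (RCLike.re (NormedSpace.exp M).trace - η * quadForm (NormedSpace.exp M) (q j)) := by
            refine Finset.sum_le_sum fun j _ => (re_trace_exp_sub_le hM hθ0.le (q j)).trans ?_
            have := hg j
            have h2 := hqR j
            rw [hη]
            gcongr
        _ = (n * (-(η / n) + 1)) * RCLike.re (NormedSpace.exp M).trace := by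
            rw [Finset.sum_sub_distrib, ← Finset.mul_sum, htr]
            simp only [Finset.sum_const, Finset.card_univ, nsmul_eq_mul]
            change n * _ - _ = _
            field_simp
            ring
        _ ≤ _ := by
            gcongr
            exact Real.add_one_le_exp _) m (fun M hM => re_trace_exp_nonneg hM)
    (Real.exp (-(θ * ((1 - γ) * m / n)))) A
    (fun s hs => by
      by_contra hlt
      push Not at hlt
      obtain ⟨v, hv⟩ := hA s hs
      have hH : (∑ i, ((-θ : ℝ) : 𝕜) • vecMulVec (q (s i)) (star (q (s i)))).IsHermitian := by
        rw [IsHermitian, conjTranspose_sum]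
        exact Finset.sum_congr rfl fun i _ => hherm (s i)
      have := quadForm_le_of_re_trace_exp_le hH hlt.le v
      rw [quadForm_sum] at this
      simp only [quadForm_smul, quadForm_vecMulVec] at this
      rw [← Finset.mul_sum] at this
      have h2 := mul_lt_mul_of_pos_left hv hθ0
      linarith)
  have h0 : RCLike.re (NormedSpace.exp (0 : Matrix ι ι 𝕜)).trace = Fintype.card ι := by
    rw [NormedSpace.exp_zero, trace_one, RCLike.natCast_re]
  rw [h0, mul_pow, ← Real.exp_nat_mul, ← le_div_iff₀ (Real.exp_pos _)] at key
  refine key.trans (le_of_eq ?_)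
  rw [div_eq_mul_inv, ← Real.exp_neg,
    show n ^ m * Real.exp (m * -(η / n)) * Fintype.card ι *
        Real.exp (- -(θ * ((1 - γ) * m / n))) =
      n ^ m * (Fintype.card ι * (Real.exp (m * -(η / n)) *
        Real.exp (- -(θ * ((1 - γ) * m / n))))) by ring, ← Real.exp_add]
  congr 3
  rw [hη, hθ]
  field_simp
  ring

end MatrixForms

/-! ### Least squares residuals -/

section LeastSquares

variable {𝕜 ι κ : Type*} [RCLike 𝕜] [Fintype ι] [Fintype κ]

theorem sqNorm_add (v w : ι → 𝕜) :
    sqNorm (v + w) = sqNorm v + 2 * RCLike.re (star v ⬝ᵥ w) + sqNorm w := by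
  have h : RCLike.re (star w ⬝ᵥ v) = RCLike.re (star v ⬝ᵥ w) := by
    rw [star_dotProduct, RCLike.star_def, RCLike.conj_re]
  rw [sqNorm_eq_re, sqNorm_eq_re, sqNorm_eq_re, star_add, add_dotProduct, dotProduct_add,
    dotProduct_add]
  simp only [map_add, h]
  ring

theorem sqNorm_sub (v w : ι → 𝕜) :
    sqNorm (v - w) = sqNorm v - 2 * RCLike.re (star v ⬝ᵥ w) + sqNorm w := by
  have h : sqNorm (-w) = sqNorm w := by simp [sqNorm]
  rw [sub_eq_add_neg, sqNorm_add, h, dotProduct_neg, map_neg]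
  ring

theorem sqNorm_smul (c : ℝ) (v : ι → 𝕜) : sqNorm ((c : 𝕜) • v) = c ^ 2 * sqNorm v := by
  simp [sqNorm, mul_pow, Finset.mul_sum]

theorem eq_zero_of_sqNorm_eq_zero {v : ι → 𝕜} (h : sqNorm v = 0) : v = 0 := by
  funext i
  have h1 := (Finset.sum_eq_zero_iff_of_nonneg (fun i _ => by positivity)).1 h i (Finset.mem_univ i)
  simpa using h1

theorem star_mulVec_dotProduct (A : Matrix ι κ 𝕜) (v : κ → 𝕜) (w : ι → 𝕜) :
    star (A *ᵥ v) ⬝ᵥ w = star v ⬝ᵥ (Aᴴ *ᵥ w) := by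
  rw [star_mulVec, dotProduct_mulVec]

variable [DecidableEq κ]

/-- Orthonormalization of the columns of a matrix of full column rank. -/
theorem exists_orthonormalization {U : Matrix ι κ 𝕜} {W : Matrix κ κ 𝕜} (hW : W * (Uᴴ * U) = 1) :
    ∃ (Q : Matrix ι κ 𝕜) (C C' : Matrix κ κ 𝕜), C * C' = 1 ∧ C' * C = 1 ∧ U = Q * C ∧ Qᴴ * Q = 1 ∧
      U * W * Uᴴ = Q * Qᴴ := by
  have hG : (Uᴴ * U).IsHermitian := isHermitian_conjTranspose_mul_self U
  obtain ⟨V, a, hV, hV', hGV⟩ := exists_diagonalization hG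
  have hsq : ∀ v, quadForm (Uᴴ * U) v = sqNorm (U *ᵥ v) := fun v => by
    rw [quadForm, sqNorm_eq_re, star_mulVec_dotProduct, mulVec_mulVec]
  have ha : ∀ l, 0 < a l := by
    intro l
    have h1 : a l = sqNorm (U *ᵥ Vᵀ l) := by rw [← hsq, hGV, quadForm_col hV]
    rw [h1]
    refine lt_of_le_of_ne (sqNorm_nonneg _) fun h => ?_
    have h2 := eq_zero_of_sqNorm_eq_zero h.symm
    have h3 : Vᵀ l = 0 := by
      calc Vᵀ l = (W * (Uᴴ * U)) *ᵥ Vᵀ l := by rw [hW, one_mulVec]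
        _ = W *ᵥ (Uᴴ *ᵥ (U *ᵥ Vᵀ l)) := by rw [mulVec_mulVec, mulVec_mulVec, Matrix.mul_assoc]
        _ = 0 := by rw [h2, mulVec_zero, mulVec_zero]
    have h4 := conjTranspose_mulVec_col hV l
    rw [h3, mulVec_zero] at h4
    simpa using congrFun h4 l
  have hs : ∀ l, (√(a l) : 𝕜) * (√(a l) : 𝕜) = (a l : 𝕜) := fun l => by
    rw [← RCLike.ofReal_mul, Real.mul_self_sqrt (ha l).le]
  have hs0 : ∀ l, ((√(a l) : ℝ) : 𝕜) ≠ 0 := fun l => by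
    simpa using (Real.sqrt_pos.2 (ha l)).ne'
  -- With Uᴴ U = V D² Vᴴ, the factors are Q = U V D⁻¹ and C = D Vᴴ.
  set D : Matrix κ κ 𝕜 := diagonal (fun l => ((√(a l) : ℝ) : 𝕜)) with hD
  set D' : Matrix κ κ 𝕜 := diagonal (fun l => ((√(a l) : ℝ) : 𝕜)⁻¹) with hD'
  have hDD : D * D' = 1 := by
    rw [hD, hD', diagonal_mul_diagonal, ← diagonal_one]
    congr 1; funext l; exact mul_inv_cancel₀ (hs0 l)
  have hDD' : D' * D = 1 := by
    rw [hD, hD', diagonal_mul_diagonal, ← diagonal_one]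
    congr 1; funext l; exact inv_mul_cancel₀ (hs0 l)
  have hDh : D'ᴴ = D' := by
    rw [hD', diagonal_conjTranspose]
    congr 1; funext l
    simp
  have hD2 : diagonal (fun l => (a l : 𝕜)) = D * D := by
    rw [hD, diagonal_mul_diagonal]; congr 1; funext l; exact (hs l).symm
  have hCC : D * Vᴴ * (V * D') = 1 := by
    rw [mul_assoc, ← mul_assoc Vᴴ, hV, one_mul, hDD]
  have hCC' : V * D' * (D * Vᴴ) = 1 := by
    rw [mul_assoc, ← mul_assoc D', hDD', one_mul, hV']
  have hU : U = U * (V * D') * (D * Vᴴ) := by rw [Matrix.mul_assoc U, hCC', Matrix.mul_one]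
  have hQQ : (U * (V * D'))ᴴ * (U * (V * D')) = 1 := by
    rw [conjTranspose_mul, conjTranspose_mul, hDh]
    calc _ = D' * Vᴴ * (Uᴴ * U) * V * D' := by simp only [Matrix.mul_assoc]
      _ = D' * (Vᴴ * V) * (D * D) * (Vᴴ * V) * D' := by rw [hGV, hD2]; simp only [mul_assoc]
      _ = (D' * D) * (D * D') := by rw [hV]; simp only [mul_assoc, one_mul]
      _ = 1 := by rw [hDD, hDD', one_mul]
  refine ⟨U * (V * D'), D * Vᴴ, V * D', hCC, hCC', hU, hQQ, ?_⟩
  have hWe : W = V * D' * (V * D')ᴴ := by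
    have h1 : Uᴴ * U * (V * D' * (V * D')ᴴ) = 1 := by
      rw [conjTranspose_mul, hDh, hGV, hD2]
      calc _ = V * D * D * (Vᴴ * V) * D' * D' * Vᴴ := by simp only [mul_assoc]
        _ = V * D * (D * D') * D' * Vᴴ := by rw [hV]; simp only [mul_assoc, one_mul]
        _ = 1 := by rw [hDD, mul_one, mul_assoc V, hDD, mul_one, hV']
    exact left_inv_eq_right_inv hW h1
  rw [hWe]
  simp only [conjTranspose_mul, Matrix.mul_assoc]

/-- Least squares with a matrix of full column rank: existence of the normal inverse and two-sided
bounds for the squared residual. -/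
theorem exists_leastSquares_residual_bounds {Q : Matrix ι κ 𝕜} {C C' : Matrix κ κ 𝕜}
    (hC : C' * C = 1) {lam : ℝ} (hlam : 0 < lam)
    (hQ : ∀ v, lam * sqNorm v ≤ sqNorm (Q *ᵥ v)) :
    ∃ W : Matrix κ κ 𝕜, (Q * C)ᴴ * (Q * C) * W = 1 ∧ W * ((Q * C)ᴴ * (Q * C)) = 1 ∧
      ∀ a y, sqNorm y - sqNorm (Qᴴ *ᵥ y) / lam ≤ sqNorm (((Q * C) *ᵥ a + y) -
          ((Q * C) * W * (Q * C)ᴴ) *ᵥ ((Q * C) *ᵥ a + y)) ∧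
        sqNorm (((Q * C) *ᵥ a + y) - ((Q * C) * W * (Q * C)ᴴ) *ᵥ ((Q * C) *ᵥ a + y)) ≤
          sqNorm y := by
  set U := Q * C with hU
  have hinj : Function.Injective (Uᴴ * U).mulVec := by
    refine (injective_iff_map_eq_zero (Uᴴ * U).mulVecLin).2 fun v hv => ?_
    rw [mulVecLin_apply] at hv
    have h1 : sqNorm (U *ᵥ v) = 0 := by
      rw [sqNorm_eq_re, star_mulVec_dotProduct, mulVec_mulVec, hv, dotProduct_zero, map_zero]
    have h2 := hQ (C *ᵥ v)
    rw [mulVec_mulVec, ← hU, h1] at h2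
    have h3 : sqNorm (C *ᵥ v) = 0 := by nlinarith [sqNorm_nonneg (C *ᵥ v)]
    have h4 := eq_zero_of_sqNorm_eq_zero h3
    rw [← one_mulVec v, ← hC, ← mulVec_mulVec, h4, mulVec_zero]
  have hunit : IsUnit (Uᴴ * U) := mulVec_injective_iff_isUnit.1 hinj
  have hdet := (isUnit_iff_isUnit_det _).1 hunit
  have hGW : Uᴴ * U * (Uᴴ * U)⁻¹ = 1 := mul_nonsing_inv _ hdet
  have hWG : (Uᴴ * U)⁻¹ * (Uᴴ * U) = 1 := nonsing_inv_mul _ hdet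
  refine ⟨(Uᴴ * U)⁻¹, hGW, hWG, fun a y => ?_⟩
  set W := (Uᴴ * U)⁻¹
  have hres : (U *ᵥ a + y) - (U * W * Uᴴ) *ᵥ (U *ᵥ a + y) = y - U *ᵥ (W *ᵥ (Uᴴ *ᵥ y)) := by
    have h1 : U * W * Uᴴ * U = U := by rw [Matrix.mul_assoc, Matrix.mul_assoc, hWG, Matrix.mul_one]
    rw [mulVec_add, mulVec_mulVec, h1, add_sub_add_left_eq_sub, mulVec_mulVec, mulVec_mulVec,
      Matrix.mul_assoc]
  rw [hres]
  obtain ⟨d, hd⟩ : ∃ d, d = W *ᵥ (Uᴴ *ᵥ y) := ⟨_, rfl⟩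
  rw [← hd]
  have hUy : Uᴴ *ᵥ y = (Uᴴ * U) *ᵥ d := by
    rw [hd, mulVec_mulVec, hGW, one_mulVec]
  have hp : RCLike.re (star (U *ᵥ d) ⬝ᵥ y) = sqNorm (U *ᵥ d) := by
    rw [star_mulVec_dotProduct, hUy, sqNorm_eq_re, star_mulVec_dotProduct, mulVec_mulVec]
  have hp' : RCLike.re (star y ⬝ᵥ (U *ᵥ d)) = sqNorm (U *ᵥ d) := by
    rw [← hp, star_dotProduct, RCLike.star_def, RCLike.conj_re]
  have hval : sqNorm (y - U *ᵥ d) = sqNorm y - sqNorm (U *ᵥ d) := by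
    rw [sqNorm_sub, hp']; ring
  rw [hval]
  refine ⟨?_, by linarith [sqNorm_nonneg (U *ᵥ d)]⟩
  have h1 := hQ (C *ᵥ d)
  rw [mulVec_mulVec, ← hU] at h1
  have h2 : RCLike.re (star (C *ᵥ d) ⬝ᵥ (Qᴴ *ᵥ y)) = sqNorm (U *ᵥ d) := by
    rw [← star_mulVec_dotProduct, mulVec_mulVec, ← hU, hp]
  -- Expanding 0 ≤ ‖λCd - Qᴴy‖² and using λ‖Cd‖² ≤ ‖Ud‖² gives λ‖Ud‖² ≤ ‖Qᴴy‖², with no operator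
  -- norm of an inverse Gram matrix.
  have h3 := sqNorm_nonneg ((lam : 𝕜) • (C *ᵥ d) - Qᴴ *ᵥ y)
  have h4 : RCLike.re (star ((lam : 𝕜) • (C *ᵥ d)) ⬝ᵥ (Qᴴ *ᵥ y)) = lam * sqNorm (U *ᵥ d) := by
    rw [star_smul, smul_dotProduct, RCLike.star_def, RCLike.conj_ofReal, smul_eq_mul,
      RCLike.re_ofReal_mul, h2]
  rw [sqNorm_sub, sqNorm_smul, h4] at h3
  have h5 : sqNorm (U *ᵥ d) ≤ sqNorm (Qᴴ *ᵥ y) / lam := by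
    rw [le_div_iff₀ hlam]
    nlinarith
  linarith

end LeastSquares

/-! ### Passage to frontal slices in the transform domain -/

section Slices

variable {𝕜 : Type*} [RCLike 𝕜] {a b d n : ℕ} (L : TubeTransform 𝕜 n)

/-- A frontal slice of a tensor in the transform domain. -/
def slice (A : Tensor3 𝕜 a b n) (k : Fin n) : Matrix (Fin a) (Fin b) 𝕜 :=
  Matrix.of fun i j => L (A i j) k

/-- A frontal slice of a tensor column in the transform domain. -/
def colSlice (A : Tensor3 𝕜 a 1 n) (k : Fin n) : Fin a → 𝕜 := fun i => L (A i 0) k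

/-- The tensor with given frontal slices in the transform domain. -/
def ofSlices (M : Fin n → Matrix (Fin a) (Fin b) 𝕜) : Tensor3 𝕜 a b n :=
  fun i j => L.symm fun k => M k i j

theorem slice_ofSlices (M : Fin n → Matrix (Fin a) (Fin b) 𝕜) (k : Fin n) :
    slice L (ofSlices L M) k = M k := by
  ext i j; simp [slice, ofSlices]

theorem slice_ext {A B : Tensor3 𝕜 a b n} (h : ∀ k, slice L A k = slice L B k) : A = B := by
  funext i j
  apply L.injective
  funext k
  exact congrFun (congrFun (h k) i) j

theorem slice_tensorMul (A : Tensor3 𝕜 a b n) (B : Tensor3 𝕜 b d n) (k : Fin n) :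
    slice L (tensorMul L A B) k = slice L A k * slice L B k := by
  ext i j; simp [slice, tensorMul, tubeMul, mul_apply]

theorem slice_ttranspose (A : Tensor3 𝕜 a b n) (k : Fin n) :
    slice L (ttranspose L A) k = (slice L A k)ᴴ := by
  ext i j; simp [slice, ttranspose]

theorem slice_tid (k : Fin n) : slice L (tid L a) k = 1 := by
  ext i j
  by_cases h : i = j <;> simp [slice, tid, tubeOne, one_apply, h]

theorem slice_sampleRows {m : ℕ} (s : Fin m → Fin a) (A : Tensor3 𝕜 a b n) (k : Fin n) :
    slice L (sampleRows s A) k = (slice L A k).submatrix s id := rfl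

theorem colSlice_sampleRows {m : ℕ} (s : Fin m → Fin a) (A : Tensor3 𝕜 a 1 n) (k : Fin n) :
    colSlice L (sampleRows s A) k = colSlice L A k ∘ s := rfl

theorem colSlice_add (A B : Tensor3 𝕜 a 1 n) (k : Fin n) :
    colSlice L (A + B) k = colSlice L A k + colSlice L B k := by
  funext i; simp [colSlice]

theorem colSlice_sub (A B : Tensor3 𝕜 a 1 n) (k : Fin n) :
    colSlice L (A - B) k = colSlice L A k - colSlice L B k := by
  funext i; simp [colSlice]

theorem colSlice_tensorMul (A : Tensor3 𝕜 a b n) (B : Tensor3 𝕜 b 1 n) (k : Fin n) :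
    colSlice L (tensorMul L A B) k = slice L A k *ᵥ colSlice L B k := by
  funext i; simp [colSlice, slice, tensorMul, tubeMul, mulVec, dotProduct]

theorem colSlice_basisColumn (j : Fin a) (k : Fin n) :
    colSlice L (basisColumn L j) k = Pi.single j 1 := by
  funext i
  by_cases h : i = j <;> simp [colSlice, basisColumn, tubeOne, h]

theorem isTInverse_iff (A B : Tensor3 𝕜 a a n) :
    IsTInverse L A B ↔ ∀ k, slice L A k * slice L B k = 1 ∧ slice L B k * slice L A k = 1 := by
  constructor
  · rintro ⟨h1, h2⟩ k
    rw [← slice_tensorMul, ← slice_tensorMul, h1, h2, slice_tid]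
    exact ⟨rfl, rfl⟩
  · intro h
    constructor <;> refine slice_ext L fun k => ?_
    · rw [slice_tensorMul, slice_tid, (h k).1]
    · rw [slice_tensorMul, slice_tid, (h k).2]

theorem exists_mulVec_of_mem_colSubspace {U : Tensor3 𝕜 a b n} {X : Tensor3 𝕜 a 1 n}
    (hX : X ∈ colSubspace L U) (k : Fin n) : ∃ x, colSlice L X k = slice L U k *ᵥ x := by
  obtain ⟨x, hx⟩ := hX
  refine ⟨fun j => L (x j) k, funext fun i => ?_⟩
  simp [colSlice, hx, slice, tubeMul, mulVec, dotProduct]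

theorem tubeNorm_sq (x : Tube 𝕜 n) : tubeNorm x ^ 2 = sqNorm x :=
  Real.sq_sqrt (by positivity)

variable {L} {c : ℝ} (hL : ∀ x : Tube 𝕜 n, tubeNorm (L x) = c * tubeNorm x)
include hL

theorem sqNorm_transform (x : Tube 𝕜 n) : sqNorm (L x) = c ^ 2 * sqNorm x := by
  rw [← tubeNorm_sq, hL, mul_pow, tubeNorm_sq]

theorem re_dotProduct_transform (x y : Tube 𝕜 n) :
    RCLike.re (star (L x) ⬝ᵥ L y) = c ^ 2 * RCLike.re (star x ⬝ᵥ y) := by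
  have h1 := sqNorm_add x y
  have h2 := sqNorm_add (L x) (L y)
  rw [← map_add, sqNorm_transform hL, sqNorm_transform hL, sqNorm_transform hL] at h2
  rw [h1] at h2
  linarith

theorem sum_sqNorm_colSlice (A : Tensor3 𝕜 a 1 n) :
    ∑ k, sqNorm (colSlice L A k) = c ^ 2 * frobNorm A ^ 2 := by
  rw [frobNorm, Real.sq_sqrt (by positivity)]
  have h : ∀ i, ∑ k, ‖L (A i 0) k‖ ^ 2 = c ^ 2 * ∑ k, ‖A i 0 k‖ ^ 2 := fun i =>
    sqNorm_transform hL (A i 0)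
  simp only [sqNorm, colSlice, Fin.sum_univ_one (M := ℝ)]
  rw [Finset.sum_comm, Finset.mul_sum]
  exact Finset.sum_congr rfl fun i _ => by rw [h]

/-- Orthogonality of tensors only controls a sum over slices. A test column living on slice k alone,
with the vector to be annihilated as its coefficients, isolates the squared norm of that vector. -/
theorem conjTranspose_mulVec_eq_zero_of_mem_orthComplement {U : Tensor3 𝕜 a b n}
    {Y : Tensor3 𝕜 a 1 n} (hY : Y ∈ orthComplement (colSubspace L U)) (k : Fin n) :
    (slice L U k)ᴴ *ᵥ colSlice L Y k = 0 := by
  set w := (slice L U k)ᴴ *ᵥ colSlice L Y k with hw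
  let x : Fin b → Tube 𝕜 n := fun j => L.symm (Pi.single k (w j))
  let X : Tensor3 𝕜 a 1 n := fun i _ => ∑ j, tubeMul L (U i j) (x j)
  have hX : X ∈ colSubspace L U := ⟨x, fun i => rfl⟩
  have hXk : ∀ k', colSlice L X k' = if k' = k then slice L U k *ᵥ w else 0 := by
    intro k'
    funext i
    by_cases h : k' = k
    · subst h
      simp [colSlice, X, x, tubeMul, slice, mulVec, dotProduct]
    · simp [colSlice, X, x, tubeMul, h]
  have h0 : (0 : ℝ) = RCLike.re (frobInner X Y) := by rw [hY X hX]; simp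
  have h1 : RCLike.re (frobInner X Y) = ∑ i, RCLike.re (star (X i 0) ⬝ᵥ Y i 0) := by
    rw [frobInner, map_sum]
    refine Finset.sum_congr rfl fun i _ => ?_
    rw [Fin.sum_univ_one]
    rfl
  have h2 : c ^ 2 * RCLike.re (frobInner X Y) =
      ∑ k', RCLike.re (star (colSlice L X k') ⬝ᵥ colSlice L Y k') := by
    rw [h1, Finset.mul_sum]
    simp only [← re_dotProduct_transform hL]
    simp only [dotProduct, map_sum]
    rw [Finset.sum_comm]
    rfl
  rw [← h0, mul_zero, Finset.sum_eq_single k (fun k' _ h => by simp [hXk, h])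
    (by simp), hXk, if_pos rfl, star_mulVec_dotProduct, ← hw, ← sqNorm_eq_re] at h2
  exact eq_zero_of_sqNorm_eq_zero h2.symm

end Slices

/-! ### Counting the bad samples -/

section Counting

/-- The upper tail of a sampled sum of nonnegative weights. -/
theorem card_sampled_sum_gt_le {α : Type*} [Fintype α] {t : α → ℝ} {B F ℓ : ℝ} {m : ℕ} (hm : 0 < m)
    (ht0 : ∀ j, 0 ≤ t j) (htB : ∀ j, t j ≤ B) (hF : ∑ j, t j = F) (hFp : 0 < F) (hℓ : 0 < ℓ)
    (hNB : F ≤ Fintype.card α * B) (A : Finset (Fin m → α))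
    (hA : ∀ s ∈ A, (1 + (√(2 * (Fintype.card α * B - F) / (m * F) * ℓ) +
      2 * (Fintype.card α * B - F) / (3 * m * F) * ℓ)) * (m / Fintype.card α) * F <
        ∑ i, t (s i)) :
    A.card ≤ (Fintype.card α : ℝ) ^ m * Real.exp (-ℓ) := by
  have hN : (0 : ℝ) < Fintype.card α := by
    rcases (Nat.cast_nonneg (α := ℝ) (Fintype.card α)).eq_or_lt with h | h
    · rw [← h] at hNB; linarith
    · exact h
  have hm' : (0 : ℝ) < m := by exact_mod_cast hm
  have hcard : ∑ _j : α, (1 : ℝ) = Fintype.card α := by simp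
  set N : ℝ := (Fintype.card α : ℝ)
  set D := N * B - F with hD
  have hD0 : 0 ≤ D := by linarith
  have hsq : √(2 * m * (F * D / N ^ 2) * ℓ) = m * F / N * √(2 * D / (m * F) * ℓ) := by
    rw [show 2 * m * (F * D / N ^ 2) * ℓ = (m * F / N) ^ 2 * (2 * D / (m * F) * ℓ) by
      field_simp, Real.sqrt_mul (by positivity), Real.sqrt_sq (by positivity)]
  refine bernstein_sampling (fun j => t j - F / N) ?_ (b := D / N) (v := F * D / N ^ 2)
    (by positivity) (fun j => ?_) hℓ ?_ m A fun s hs => ?_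
  · rw [Finset.sum_sub_distrib, hF, Finset.sum_const, Finset.card_univ, nsmul_eq_mul]
    change F - N * (F / N) = 0
    field_simp; ring
  · have := htB j
    rw [hD, sub_div, mul_div_cancel_left₀ _ hN.ne']
    linarith
  · have h1 : ∀ j, (t j - F / N) ^ 2 ≤ (B - 2 * (F / N)) * t j + (F / N) ^ 2 * 1 := fun j => by
      nlinarith [ht0 j, htB j, mul_nonneg (ht0 j) (sub_nonneg.2 (htB j))]
    refine (Finset.sum_le_sum fun j _ => h1 j).trans (le_of_eq ?_)
    rw [Finset.sum_add_distrib, ← Finset.mul_sum, ← Finset.mul_sum, hF, hcard]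
    change _ = N * _
    rw [hD]; field_simp; ring
  · have h := hA s hs
    rw [hsq, Finset.sum_sub_distrib, Finset.sum_const, Finset.card_univ, nsmul_eq_mul,
      Fintype.card_fin]
    have e : (1 + (√(2 * D / (m * F) * ℓ) + 2 * D / (3 * m * F) * ℓ)) * (m / N) * F =
        m * F / N * √(2 * D / (m * F) * ℓ) + 2 * (D / N) * ℓ / 3 + m * (F / N) := by
      field_simp; ring
    linarith

/-- The lower tail of a sampled sum of nonnegative weights. -/
theorem card_sampled_sum_lt_le {α : Type*} [Fintype α] {t : α → ℝ} {B F ℓ : ℝ} {m : ℕ} (hm : 0 < m)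
    (ht0 : ∀ j, 0 ≤ t j) (htB : ∀ j, t j ≤ B) (hF : ∑ j, t j = F) (hFp : 0 < F) (hℓ : 0 < ℓ)
    (hNB : F ≤ Fintype.card α * B) (A : Finset (Fin m → α))
    (hA : ∀ s ∈ A, ∑ i, t (s i) <
      (m * (1 - (√(2 * (Fintype.card α * B - F) / (m * F) * ℓ) +
        2 * (Fintype.card α * B - F) / (3 * m * F) * ℓ)) - 2 / 3 * ℓ) * (F / Fintype.card α)) :
    A.card ≤ (Fintype.card α : ℝ) ^ m * Real.exp (-ℓ) := by
  have hN : (0 : ℝ) < Fintype.card α := by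
    rcases (Nat.cast_nonneg (α := ℝ) (Fintype.card α)).eq_or_lt with h | h
    · rw [← h] at hNB; linarith
    · exact h
  have hm' : (0 : ℝ) < m := by exact_mod_cast hm
  have hcard : ∑ _j : α, (1 : ℝ) = Fintype.card α := by simp
  set N : ℝ := (Fintype.card α : ℝ)
  set D := N * B - F with hD
  have hD0 : 0 ≤ D := by linarith
  have hsq : √(2 * m * (F * D / N ^ 2) * ℓ) = m * F / N * √(2 * D / (m * F) * ℓ) := by
    rw [show 2 * m * (F * D / N ^ 2) * ℓ = (m * F / N) ^ 2 * (2 * D / (m * F) * ℓ) by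
      field_simp, Real.sqrt_mul (by positivity), Real.sqrt_sq (by positivity)]
  -- The deviation downwards is bounded by F/N instead of B - F/N. Its linear Bernstein term is the
  -- extra (2/3)ℓ; the linear term of α is simply dropped.
  refine bernstein_sampling (fun j => F / N - t j) ?_ (b := F / N) (v := F * D / N ^ 2)
    (by positivity) (fun j => ?_) hℓ ?_ m A fun s hs => ?_
  · rw [Finset.sum_sub_distrib, hF, Finset.sum_const, Finset.card_univ, nsmul_eq_mul]
    change N * (F / N) - F = 0
    field_simp; ring
  · linarith [ht0 j]
  · have h1 : ∀ j, (F / N - t j) ^ 2 ≤ (B - 2 * (F / N)) * t j + (F / N) ^ 2 * 1 := fun j => by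
      nlinarith [ht0 j, htB j, mul_nonneg (ht0 j) (sub_nonneg.2 (htB j))]
    refine (Finset.sum_le_sum fun j _ => h1 j).trans (le_of_eq ?_)
    rw [Finset.sum_add_distrib, ← Finset.mul_sum, ← Finset.mul_sum, hF, hcard]
    change _ = N * _
    rw [hD]; field_simp; ring
  · have h := hA s hs
    rw [hsq, Finset.sum_sub_distrib, Finset.sum_const, Finset.card_univ, nsmul_eq_mul,
      Fintype.card_fin]
    have e : (m * (1 - (√(2 * D / (m * F) * ℓ) + 2 * D / (3 * m * F) * ℓ)) - 2 / 3 * ℓ) * (F / N) =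
        m * (F / N) - m * F / N * √(2 * D / (m * F) * ℓ) - 2 * (F / N) * ℓ / 3 -
          2 * D / (3 * N) * ℓ := by
      field_simp; ring
    have : 0 ≤ 2 * D / (3 * N) * ℓ := by positivity
    linarith

variable {𝕜 : Type*} [RCLike 𝕜] {N r n m : ℕ}

/-- The sampled Gram matrices of several matrices with orthonormal columns are simultaneously well
conditioned except for few samples. -/
theorem card_sampled_gram_le (Q : Fin n → Matrix (Fin N) (Fin r) 𝕜) (hQ : ∀ k, (Q k)ᴴ * Q k = 1)
    {R γ δ : ℝ} (hR : 0 < R) (hQR : ∀ j, ∑ k, ∑ l, ‖Q k j l‖ ^ 2 ≤ R) (hγ : 0 < γ) (hδ : 0 < δ)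
    (hr : 0 < r) (hn : 0 < n) (hN : 0 < N)
    (hγm : γ ^ 2 * m = 8 / 3 * (N * R) * Real.log (2 * r * n / δ))
    (A : Finset (Fin m → Fin N))
    (hA : ∀ s ∈ A, ∃ k v, sqNorm ((Q k).submatrix s id *ᵥ v) < (1 - γ) * m / N * sqNorm v) :
    A.card ≤ (N : ℝ) ^ m * (δ / 2) := by
  classical
  have hr' : (0 : ℝ) < r := by exact_mod_cast hr
  have hn' : (0 : ℝ) < n := by exact_mod_cast hn
  have hN' : (0 : ℝ) < N := by exact_mod_cast hN
  have hk : ∀ k, ((A.filter fun s => ∃ v, sqNorm ((Q k).submatrix s id *ᵥ v) <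
      (1 - γ) * m / N * sqNorm v).card : ℝ) ≤ (N : ℝ) ^ m * (r * (δ / (2 * r * n))) := by
    intro k
    have hsum : ∑ j, vecMulVec (fun l => star (Q k j l)) (star fun l => star (Q k j l)) = 1 := by
      rw [← hQ k]
      ext l l'
      simp [Matrix.sum_apply, vecMulVec_apply, mul_apply]
    have := matrix_chernoff_sampling (fun j l => star (Q k j l)) hsum hR
      (fun j => by
        refine le_trans ?_ (hQR j)
        simp only [sqNorm, norm_star]
        exact Finset.single_le_sum (f := fun k => ∑ l, ‖Q k j l‖ ^ 2)
          (fun _ _ => by positivity) (Finset.mem_univ k)) hγ m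
      (A.filter fun s => ∃ v, sqNorm ((Q k).submatrix s id *ᵥ v) <
        (1 - γ) * m / N * sqNorm v)
      (fun s hs => by
        obtain ⟨v, hv⟩ := (Finset.mem_filter.1 hs).2
        refine ⟨v, ?_⟩
        rw [Fintype.card_fin]
        refine lt_of_eq_of_lt ?_ hv
        simp [sqNorm, mulVec, dotProduct])
    simp only [Fintype.card_fin] at this
    -- The Chernoff exponential is δ/(2rn): the dimension cancels r, and the union over slices
    -- cancels n.
    rwa [show 3 / 8 * γ ^ 2 * m / (N * R) = Real.log (2 * r * n / δ) by
      rw [mul_assoc, hγm]; field_simp, ← Real.log_inv,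
      Real.exp_log (by positivity), inv_div] at this
  have hsub : A ⊆ Finset.univ.biUnion fun k => A.filter fun s =>
      ∃ v, sqNorm ((Q k).submatrix s id *ᵥ v) < (1 - γ) * m / N * sqNorm v := by
    intro s hs
    obtain ⟨k, v, hv⟩ := hA s hs
    exact Finset.mem_biUnion.2 ⟨k, Finset.mem_univ _, Finset.mem_filter.2 ⟨hs, v, hv⟩⟩
  calc (A.card : ℝ) ≤ ∑ k : Fin n, ((A.filter fun s => ∃ v, sqNorm ((Q k).submatrix s id *ᵥ v) <
        (1 - γ) * m / N * sqNorm v).card : ℝ) := by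
        exact_mod_cast (Finset.card_le_card hsub).trans Finset.card_biUnion_le
    _ ≤ ∑ _k : Fin n, (N : ℝ) ^ m * (r * (δ / (2 * r * n))) := Finset.sum_le_sum fun k _ => hk k
    _ = (N : ℝ) ^ m * (δ / 2) := by
        rw [Finset.sum_const, Finset.card_univ, Fintype.card_fin, nsmul_eq_mul]
        field_simp

/-- The sampled inner products of vectors with matrices to whose columns they are orthogonal are
small except for few samples. -/
theorem card_sampled_inner_le (Q : Fin n → Matrix (Fin N) (Fin r) 𝕜) (y : Fin n → Fin N → 𝕜)
    (hy : ∀ k, (Q k)ᴴ *ᵥ y k = 0) {R B F ℓ : ℝ} (hR : 0 < R)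
    (hQR : ∀ j, ∑ k, ∑ l, ‖Q k j l‖ ^ 2 ≤ R) (hN : 0 < N) (hm : 0 < m)
    (hB : ∀ j, ∑ k, ‖y k j‖ ^ 2 ≤ B) (hF : ∑ j, ∑ k, ‖y k j‖ ^ 2 = F) (hFp : 0 < F) (hℓ : 1 ≤ ℓ)
    (hBF : ℓ * (N * B) ≤ m * F) (A : Finset (Fin m → Fin N))
    (hA : ∀ s ∈ A, m * (R * F / N) * ((1 + 2 * √ℓ) ^ 2 - 2 / 3 * ℓ) <
      ∑ k, sqNorm (((Q k).submatrix s id)ᴴ *ᵥ (y k ∘ s))) :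
    A.card ≤ (N : ℝ) ^ m * Real.exp (-ℓ) := by
  have hN' : (0 : ℝ) < N := by exact_mod_cast hN
  have hm' : (0 : ℝ) < m := by exact_mod_cast hm
  set v := R * F / N with hv
  have hvp : 0 < v := by positivity
  -- All slices are collected in one vector per row, so a single vector inequality, without a union
  -- bound, treats them together.
  let z : Fin N → EuclideanSpace 𝕜 (Fin n × Fin r) := fun j =>
    WithLp.toLp 2 fun p => star (Q p.1 j p.2) * y p.1 j
  have hzn : ∀ j, ‖z j‖ ^ 2 ≤ R * ∑ k, ‖y k j‖ ^ 2 := by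
    intro j
    rw [EuclideanSpace.norm_sq_eq, Fintype.sum_prod_type, Finset.mul_sum]
    refine Finset.sum_le_sum fun k _ => ?_
    simp only [z, norm_mul, norm_star, mul_pow]
    rw [← Finset.sum_mul]
    gcongr
    exact (Finset.single_le_sum (f := fun k => ∑ l, ‖Q k j l‖ ^ 2)
      (fun _ _ => by positivity) (Finset.mem_univ k)).trans (hQR j)
  have hz0 : ∑ j, z j = 0 := by
    ext p
    have := congrFun (hy p.1) p.2
    simpa [z, mulVec, dotProduct] using this
  have hzs : ∀ s : Fin m → Fin N, ∑ k, sqNorm (((Q k).submatrix s id)ᴴ *ᵥ (y k ∘ s)) =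
      ‖∑ i, z (s i)‖ ^ 2 := by
    intro s
    rw [EuclideanSpace.norm_sq_eq, Fintype.sum_prod_type]
    refine Finset.sum_congr rfl fun k _ => ?_
    rw [sqNorm]
    refine Finset.sum_congr rfl fun l _ => ?_
    congr 2
    simp [z, mulVec, dotProduct]
  have hℓ0 : 0 < ℓ := by linarith
  have hsℓ : √ℓ * √ℓ = ℓ := Real.mul_self_sqrt hℓ0.le
  have hs1 : 1 ≤ √ℓ := Real.one_le_sqrt.2 hℓ
  set lam := √(ℓ / (m * v)) with hlam
  have hlam2 : lam ^ 2 * (m * v) = ℓ := by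
    rw [hlam, Real.sq_sqrt (by positivity)]; field_simp
  have hlams : lam * √(m * v) = √ℓ := by
    rw [hlam, ← Real.sqrt_mul (by positivity)]
    congr 1; field_simp
  -- 9/5 is small enough for (1 + (9/5)√ℓ)² ≤ (1 + 2√ℓ)² - (2/3)ℓ, and large enough for the exponent
  -- -(21/20)ℓ - √ℓ to be at most -ℓ - 1, where e⁻¹ ≤ 1/2 absorbs the factor 2.
  have key := norm_sum_sampling (𝕜 := 𝕜) z hz0 (lam := lam) (v := v)
    (r := √(m * v) * (1 + 9 / 5 * √ℓ)) (Real.sqrt_nonneg _)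
    (fun j => by
      refine abs_le_one_iff_mul_self_le_one.2 ?_ |> fun h => (le_abs_self _).trans h
      have h1 : ‖z j‖ ^ 2 ≤ R * B := (hzn j).trans (by gcongr; exact hB j)
      have h2 : lam * ‖z j‖ * (lam * ‖z j‖) = ℓ / (m * v) * ‖z j‖ ^ 2 := by
        rw [← Real.sq_sqrt (show 0 ≤ ℓ / (m * v) by positivity), ← hlam]; ring
      rw [h2]
      calc ℓ / (m * v) * ‖z j‖ ^ 2 ≤ ℓ / (m * v) * (R * B) := by gcongr
        _ = ℓ * (N * B) / (m * F) := by rw [hv]; field_simp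
        _ ≤ 1 := div_le_one_of_le₀ hBF (by positivity))
    (by
      rw [Fintype.card_fin, hv, mul_div_cancel₀ _ hN'.ne', ← hF, Finset.mul_sum]
      exact Finset.sum_le_sum fun j _ => hzn j) m A
    (fun s hs => by
      have h1 := hA s hs
      rw [hzs] at h1
      refine abs_le_of_sq_le_sq' ?_ (norm_nonneg _) |>.2
      rw [mul_pow, Real.sq_sqrt (by positivity)]
      refine le_trans ?_ h1.le
      gcongr
      nlinarith)
  rw [Fintype.card_fin] at key
  refine key.trans ?_
  gcongr
  have e : 3 / 4 * (m * lam ^ 2 * v) - lam * (√(m * v) * (1 + 9 / 5 * √ℓ)) =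
      3 / 4 * ℓ - √ℓ - 9 / 5 * ℓ := by
    rw [← mul_assoc lam, hlams, show m * lam ^ 2 * v = lam ^ 2 * (m * v) by ring, hlam2]
    linear_combination (-9 / 5) * hsℓ
  rw [e]
  have h2 : Real.exp (3 / 4 * ℓ - √ℓ - 9 / 5 * ℓ) ≤ Real.exp (-1 + -ℓ) :=
    Real.exp_le_exp.2 (by linarith)
  rw [Real.exp_add] at h2
  have h3 : Real.exp (-1) ≤ 1 / 2 := by
    rw [Real.exp_neg, ← one_div]
    have := Real.add_one_le_exp (1 : ℝ)
    gcongr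
    linarith
  nlinarith [Real.exp_pos (-ℓ)]

end Counting

/-! ### From counts to probabilities, and from slices to tensors -/

section Sampling

/-- An event that fails for few samples has a high probability under independent uniform sampling. -/
theorem le_real_of_card_filter_le {N m : ℕ} {Ω₀ : Type*} [MeasurableSpace Ω₀] (prob : Measure Ω₀)
    [IsProbabilityMeasure prob] (Ω : Fin m → Ω₀ → Fin N)
    (hΩ_indep : iIndepFun Ω prob)
    (hΩ_unif : ∀ i j, prob.real {ω | Ω i ω = j} = 1 / (N : ℝ)) {ε : ℝ}
    (G : Set (Fin m → Fin N)) (A : Finset (Fin m → Fin N)) (hGA : ∀ s, s ∉ A → s ∈ G)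
    (hN : 0 < N) (hA : (A.card : ℝ) ≤ (N : ℝ) ^ m * ε) :
    1 - ε ≤ prob.real {ω | (fun i => Ω i ω) ∈ G} := by
  have hN' : (0 : ℝ) < N := by exact_mod_cast hN
  have hs : ∀ s : Fin m → Fin N, prob.real {ω | ∀ i, Ω i ω = s i} = (1 / (N : ℝ)) ^ m := by
    intro s
    have h := hΩ_indep.measure_inter_preimage_eq_mul Finset.univ (sets := fun i => {s i})
      (fun i _ => MeasurableSet.singleton _)
    have he : {ω | ∀ i, Ω i ω = s i} = ⋂ i ∈ Finset.univ, Ω i ⁻¹' {s i} := by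
      ext ω; simp
    rw [he, measureReal_def, h, ENNReal.toReal_prod]
    have h2 : ∀ i, (prob (Ω i ⁻¹' {s i})).toReal = 1 / (N : ℝ) := fun i => hΩ_unif i (s i)
    simp [h2]
  have hcover : (Set.univ : Set Ω₀) ⊆
      {ω | (fun i => Ω i ω) ∈ G} ∪ ⋃ s ∈ A, {ω | ∀ i, Ω i ω = s i} := by
    intro ω _
    by_cases h : (fun i => Ω i ω) ∈ A
    · exact Or.inr (Set.mem_biUnion h fun i => rfl)
    · exact Or.inl (hGA _ h)
  have h1 : 1 ≤ prob.real {ω | (fun i => Ω i ω) ∈ G} +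
      prob.real (⋃ s ∈ A, {ω | ∀ i, Ω i ω = s i}) := by
    rw [← probReal_univ (μ := prob)]
    exact (measureReal_mono hcover).trans (measureReal_union_le _ _)
  have h2 : prob.real (⋃ s ∈ A, {ω | ∀ i, Ω i ω = s i}) ≤ ε := by
    refine (measureReal_biUnion_finset_le _ _).trans ?_
    simp only [hs, Finset.sum_const, nsmul_eq_mul, one_div, inv_pow]
    rw [← div_eq_mul_inv, div_le_iff₀ (by positivity), mul_comm]
    exact hA
  linarith

variable {𝕜 : Type*} [RCLike 𝕜] {N r n m : ℕ} {L : TubeTransform 𝕜 n} {c : ℝ}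

theorem exists_slice_orthonormalization {U : Tensor3 𝕜 N r n} {P : Tensor3 𝕜 N N n}
    (hP : IsColProjection L U P) :
    ∃ (Q : Fin n → Matrix (Fin N) (Fin r) 𝕜) (C C' : Fin n → Matrix (Fin r) (Fin r) 𝕜),
      (∀ k, C k * C' k = 1) ∧ (∀ k, C' k * C k = 1) ∧ (∀ k, slice L U k = Q k * C k) ∧
      (∀ k, (Q k)ᴴ * Q k = 1) ∧ ∀ k, slice L P k = Q k * (Q k)ᴴ := by
  obtain ⟨W, hW, rfl⟩ := hP
  rw [isTInverse_iff] at hW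
  simp only [slice_tensorMul, slice_ttranspose] at hW
  choose Q C C' h1 h2 h3 h4 h5 using fun k => exists_orthonormalization (hW k).2
  refine ⟨Q, C, C', h1, h2, h3, h4, fun k => ?_⟩
  rw [slice_tensorMul, slice_tensorMul, slice_ttranspose, h5]

theorem sqNorm_col_projection {Q : Matrix (Fin N) (Fin r) 𝕜} (hQ : Qᴴ * Q = 1) (j : Fin N) :
    sqNorm ((Q * Qᴴ) *ᵥ Pi.single j 1) = ∑ l, ‖Q j l‖ ^ 2 := by
  rw [sqNorm_eq_re, star_mulVec_dotProduct, mulVec_mulVec, conjTranspose_mul,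
    conjTranspose_conjTranspose, Matrix.mul_assoc, ← Matrix.mul_assoc Qᴴ, hQ, Matrix.one_mul,
    ← mulVec_mulVec, ← conjTranspose_conjTranspose Q, conjTranspose_conjTranspose Qᴴ,
    ← star_mulVec_dotProduct, ← sqNorm_eq_re, sqNorm]
  simp

theorem sum_sqNorm_entries {Q : Matrix (Fin N) (Fin r) 𝕜} (hQ : Qᴴ * Q = 1) :
    ∑ j, ∑ l, ‖Q j l‖ ^ 2 = (r : ℝ) := by
  have h : RCLike.re (Qᴴ * Q).trace = ∑ j, ∑ l, ‖Q j l‖ ^ 2 := by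
    rw [Finset.sum_comm, trace, map_sum]
    refine Finset.sum_congr rfl fun l _ => ?_
    rw [diag_apply, mul_apply, map_sum]
    refine Finset.sum_congr rfl fun j _ => ?_
    rw [conjTranspose_apply, RCLike.star_def, RCLike.conj_mul]
    norm_cast
  rw [← h, hQ, trace_one, Fintype.card_fin, RCLike.natCast_re]

theorem sum_sqNorm_entries_le_coherence (hL : ∀ x : Tube 𝕜 n, tubeNorm (L x) = c * tubeNorm x)
    {P : Tensor3 𝕜 N N n} {Q : Fin n → Matrix (Fin N) (Fin r) 𝕜} (hQ : ∀ k, (Q k)ᴴ * Q k = 1)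
    (hP : ∀ k, slice L P k = Q k * (Q k)ᴴ) (hr : 0 < r) (j : Fin N) :
    ∑ k, ∑ l, ‖Q k j l‖ ^ 2 ≤ c ^ 2 * r * coherence L r P / N := by
  have hN : (0 : ℝ) < N := by exact_mod_cast j.pos
  have hr' : (0 : ℝ) < r := by exact_mod_cast hr
  have h1 : ∑ k, ∑ l, ‖Q k j l‖ ^ 2 = c ^ 2 * frobNorm (tensorMul L P (basisColumn L j)) ^ 2 := by
    rw [← sum_sqNorm_colSlice hL]
    refine Finset.sum_congr rfl fun k _ => ?_
    rw [colSlice_tensorMul, colSlice_basisColumn, hP, sqNorm_col_projection (hQ k)]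
  have h2 := le_ciSup (f := fun j : Fin N => frobNorm (tensorMul L P (basisColumn L j)) ^ 2)
    (Set.finite_range _).bddAbove j
  rw [h1, coherence]
  calc _ ≤ c ^ 2 * ⨆ j : Fin N, frobNorm (tensorMul L P (basisColumn L j)) ^ 2 := by gcongr
    _ = _ := by field_simp

theorem sampled_residual_bounds (hL : ∀ x : Tube 𝕜 n, tubeNorm (L x) = c * tubeNorm x)
    {U : Tensor3 𝕜 N r n} {X Y : Tensor3 𝕜 N 1 n} (hX : X ∈ colSubspace L U)
    {Q : Fin n → Matrix (Fin N) (Fin r) 𝕜} {C C' : Fin n → Matrix (Fin r) (Fin r) 𝕜}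
    (hC : ∀ k, C' k * C k = 1) (hU : ∀ k, slice L U k = Q k * C k) (s : Fin m → Fin N)
    {lam : ℝ} (hlam : 0 < lam)
    (hs : ∀ k v, lam * sqNorm v ≤ sqNorm ((Q k).submatrix s id *ᵥ v)) :
    ∃ PΩ, IsColProjection L (sampleRows s U) PΩ ∧
      ∑ k, sqNorm (colSlice L Y k ∘ s) -
          (∑ k, sqNorm (((Q k).submatrix s id)ᴴ *ᵥ (colSlice L Y k ∘ s))) / lam ≤
        c ^ 2 * frobNorm (sampleRows s (X + Y) - tensorMul L PΩ (sampleRows s (X + Y))) ^ 2 ∧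
      c ^ 2 * frobNorm (sampleRows s (X + Y) - tensorMul L PΩ (sampleRows s (X + Y))) ^ 2 ≤
        ∑ k, sqNorm (colSlice L Y k ∘ s) := by
  choose W h1 h2 h3 using fun k => exists_leastSquares_residual_bounds (hC k) hlam (hs k)
  choose x hx using exists_mulVec_of_mem_colSubspace L hX
  have hUs : ∀ k, slice L (sampleRows s U) k = (Q k).submatrix s id * C k := fun k => by
    rw [slice_sampleRows, hU]
    rfl
  refine ⟨tensorMul L (tensorMul L (sampleRows s U) (ofSlices L W))
    (ttranspose L (sampleRows s U)), ⟨ofSlices L W, ?_, rfl⟩, ?_⟩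
  · rw [isTInverse_iff]
    intro k
    rw [slice_tensorMul, slice_ttranspose, slice_ofSlices, hUs]
    exact ⟨h1 k, h2 k⟩
  · have hres : ∀ k, colSlice L (sampleRows s (X + Y) -
        tensorMul L (tensorMul L (tensorMul L (sampleRows s U) (ofSlices L W))
          (ttranspose L (sampleRows s U))) (sampleRows s (X + Y))) k =
        (((Q k).submatrix s id * C k) *ᵥ x k + colSlice L Y k ∘ s) -
          (((Q k).submatrix s id * C k) * W k * ((Q k).submatrix s id * C k)ᴴ) *ᵥ
            (((Q k).submatrix s id * C k) *ᵥ x k + colSlice L Y k ∘ s) := by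
      intro k
      have hT : colSlice L (sampleRows s (X + Y)) k =
          ((Q k).submatrix s id * C k) *ᵥ x k + colSlice L Y k ∘ s := by
        rw [colSlice_sampleRows, colSlice_add, hx, hU]
        rfl
      rw [colSlice_sub, colSlice_tensorMul, slice_tensorMul, slice_tensorMul, slice_ttranspose,
        slice_ofSlices, hUs, hT]
    rw [← sum_sqNorm_colSlice hL]
    simp only [hres]
    rw [Finset.sum_div, ← Finset.sum_sub_distrib]
    exact ⟨Finset.sum_le_sum fun k _ => (h3 k _ _).1, Finset.sum_le_sum fun k _ => (h3 k _ _).2⟩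

theorem frobNorm_sub_projection_sq (hL : ∀ x : Tube 𝕜 n, tubeNorm (L x) = c * tubeNorm x)
    {U : Tensor3 𝕜 N r n} {P : Tensor3 𝕜 N N n} {X Y : Tensor3 𝕜 N 1 n} (hX : X ∈ colSubspace L U)
    {Q : Fin n → Matrix (Fin N) (Fin r) 𝕜} {C : Fin n → Matrix (Fin r) (Fin r) 𝕜}
    (hU : ∀ k, slice L U k = Q k * C k)
    (hQ : ∀ k, (Q k)ᴴ * Q k = 1) (hP : ∀ k, slice L P k = Q k * (Q k)ᴴ)
    (hY : ∀ k, (Q k)ᴴ *ᵥ colSlice L Y k = 0) :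
    c ^ 2 * frobNorm (X + Y - tensorMul L P (X + Y)) ^ 2 = c ^ 2 * frobNorm Y ^ 2 := by
  rw [← sum_sqNorm_colSlice hL, ← sum_sqNorm_colSlice hL]
  refine Finset.sum_congr rfl fun k _ => ?_
  obtain ⟨x, hx⟩ := exists_mulVec_of_mem_colSubspace L hX k
  have h : (Q k * (Q k)ᴴ * (Q k * C k)) = Q k * C k := by
    rw [Matrix.mul_assoc, ← Matrix.mul_assoc _ (Q k), hQ, Matrix.one_mul]
  rw [colSlice_sub, colSlice_tensorMul, colSlice_add, hx, hU, hP, mulVec_add, mulVec_mulVec, h,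
    ← mulVec_mulVec (colSlice L Y k), hY, mulVec_zero, add_zero, add_sub_cancel_left]

end Sampling

/-! ### Assembly of the bound -/

set_option maxHeartbeats 800000 in
theorem theorem1 {𝕜 : Type*} [RCLike 𝕜] {n₁ n₂ n₃ m : ℕ} (hn₂ : 0 < n₂) (hn₃ : 0 < n₃)
    -- the transform, which scales Euclidean norms by the constant `c`
    (L : TubeTransform 𝕜 n₃) (c : ℝ) (hc : 0 < c)
    (hL : ∀ x : Tube 𝕜 n₃, tubeNorm (L x) = c * tubeNorm x)
    -- the subspace spanned by the columns of `U`, and its orthogonal projection `P`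
    (U : Tensor3 𝕜 n₁ n₂ n₃) (P : Tensor3 𝕜 n₁ n₁ n₃) (hP : IsColProjection L U P)
    -- the signal and its decomposition
    (T X Y : Tensor3 𝕜 n₁ 1 n₃) (hT : T = X + Y) (hX : X ∈ colSubspace L U)
    (hY : Y ∈ orthComplement (colSubspace L U))
    -- `m` indices drawn independently and uniformly, with replacement
    {Ω₀ : Type*} [MeasurableSpace Ω₀] (prob : Measure Ω₀) [IsProbabilityMeasure prob]
    (Ω : Fin m → Ω₀ → Fin n₁) (hΩ_meas : ∀ i, Measurable (Ω i)) (hΩ_indep : iIndepFun Ω prob)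
    (hΩ_unif : ∀ i j, prob.real {ω | Ω i ω = j} = 1 / (n₁ : ℝ))
    (δ : ℝ) (hδ : 0 < δ)
    (hm : 8 / 3 * n₂ * coherence L n₂ P * Real.log (2 * n₂ * n₃ / δ) ≤ (m : ℝ))
    (hγ : gammaBound c (coherence L n₂ P) δ m n₂ n₃ < 1) :
    1 - 4 * δ ≤ prob.real {ω | ∃ PΩ : Tensor3 𝕜 m m n₃,
      IsColProjection L (sampleRows (fun i => Ω i ω) U) PΩ ∧
      (m * (1 - alphaBound m δ Y) -
            c ^ 2 * n₂ * coherence L n₂ P *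
              (betaBound δ / (1 - gammaBound c (coherence L n₂ P) δ m n₂ n₃))) / n₁ *
          frobNorm (T - tensorMul L P T) ^ 2 ≤
        frobNorm (sampleRows (fun i => Ω i ω) T -
          tensorMul L PΩ (sampleRows (fun i => Ω i ω) T)) ^ 2 ∧
      frobNorm (sampleRows (fun i => Ω i ω) T -
          tensorMul L PΩ (sampleRows (fun i => Ω i ω) T)) ^ 2 ≤
        (1 + alphaBound m δ Y) * (m / n₁) * frobNorm (T - tensorMul L P T) ^ 2} := by
  rcases le_or_gt (1 / 4) δ with hδ4 | hδ4
  · exact le_trans (by linarith) measureReal_nonneg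
  subst hT
  classical
  obtain ⟨Q, C, C', hCC', hC'C, hU, hQ, hPQ⟩ := exists_slice_orthonormalization hP
  set μ := coherence L n₂ P with hμ
  set γ := gammaBound c μ δ m n₂ n₃ with hγdef
  set Γ := c ^ 2 * n₂ * μ with hΓ
  have hQR := sum_sqNorm_entries_le_coherence hL hQ hPQ hn₂
  rw [← hμ, ← hΓ] at hQR
  have hn₂' : (1 : ℝ) ≤ n₂ := by exact_mod_cast hn₂
  have hn₃' : (1 : ℝ) ≤ n₃ := by exact_mod_cast hn₃
  have htot : ∑ j, ∑ k, ∑ l, ‖Q k j l‖ ^ 2 = (n₃ : ℝ) * n₂ := by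
    rw [Finset.sum_comm]
    simp only [sum_sqNorm_entries (hQ _)]
    simp
  have hnn : (1 : ℝ) ≤ n₃ * n₂ := one_le_mul_of_one_le_of_one_le hn₃' hn₂'
  have hN : 0 < n₁ := by
    rcases Nat.eq_zero_or_pos n₁ with rfl | h
    · simp at htot
      rcases htot with h | h <;> omega
    · exact h
  have hN' : (0 : ℝ) < n₁ := by exact_mod_cast hN
  -- The squared entries of all `Q k` sum to n₂n₃ ≥ 1, while each of the n₁ rows carries at most
  -- Γ/n₁.
  have hΓ1 : 1 ≤ Γ := by
    refine hnn.trans ?_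
    rw [← htot]
    refine (Finset.sum_le_sum fun j _ => hQR j).trans (le_of_eq ?_)
    rw [Finset.sum_const, Finset.card_univ, Fintype.card_fin, nsmul_eq_mul]
    field_simp
  have hc2 : 0 < c ^ 2 := by positivity
  have hμn : 0 < n₂ * μ := by
    have : 0 < c ^ 2 * (n₂ * μ) := by rw [← mul_assoc]; linarith
    exact pos_of_mul_pos_right this hc2.le
  set ℓ := Real.log (1 / δ) with hℓ
  have hinv : 4 < 1 / δ := by rw [lt_div_iff₀ hδ]; linarith
  have hℓ1 : 1 ≤ ℓ := by
    rw [hℓ, Real.le_log_iff_exp_le (by positivity)]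
    linarith [Real.exp_one_lt_d9]
  have hexpℓ : Real.exp (-ℓ) = δ := by
    rw [hℓ, ← Real.log_inv, one_div, inv_inv, Real.exp_log hδ]
  have hlogℓ : ℓ ≤ Real.log (2 * n₂ * n₃ / δ) := by
    refine Real.log_le_log (by positivity) ?_
    gcongr
    linarith
  set Λ := Real.log (2 * n₂ * n₃ / δ) with hΛ
  have hm' : (0 : ℝ) < m := lt_of_lt_of_le (by linarith [mul_pos hμn (by linarith : 0 < Λ)]) hm
  have hm0 : 0 < m := by exact_mod_cast hm'
  have hγarg : 8 * c ^ 2 * n₂ * μ / (3 * m) * Λ = 8 / 3 * Γ * Λ / m := by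
    rw [hΓ]; field_simp
  have hγ2 : γ ^ 2 * m = 8 / 3 * Γ * Λ := by
    have h0 : 0 ≤ 8 / 3 * Γ * Λ / m := by
      have : 0 ≤ Λ := by linarith
      positivity
    rw [hγdef, gammaBound, ← hΛ, hγarg, Real.sq_sqrt h0]
    field_simp
  have hγ0 : 0 < γ := by
    rw [hγdef, gammaBound, ← hΛ, hγarg]
    have : 0 < Λ := by linarith
    exact Real.sqrt_pos.2 (by positivity)
  have hℓm : ℓ ≤ 3 / 8 * m := by
    have h1 : γ ^ 2 * m ≤ m := mul_le_of_le_one_left hm'.le (pow_le_one₀ hγ0.le hγ.le)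
    have h2 : Λ ≤ Γ * Λ := le_mul_of_one_le_left (by linarith) hΓ1
    linarith
  set R := Γ / n₁ with hR
  have hRp : 0 < R := by positivity
  have hNR : n₁ * R = Γ := by rw [hR]; field_simp
  set y : Fin n₃ → Fin n₁ → 𝕜 := fun k => colSlice L Y k with hy
  have hQy : ∀ k, (Q k)ᴴ *ᵥ y k = 0 := by
    intro k
    have h := conjTranspose_mulVec_eq_zero_of_mem_orthComplement hL hY k
    rw [hU, conjTranspose_mul, ← mulVec_mulVec] at h
    have h2 : (C' k)ᴴ * (C k)ᴴ = 1 := by rw [← conjTranspose_mul, hCC', conjTranspose_one]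
    rw [← one_mulVec ((Q k)ᴴ *ᵥ y k), ← h2, ← mulVec_mulVec, h, mulVec_zero]
  have hTP := frobNorm_sub_projection_sq hL hX hU hQ hPQ hQy
  have hTP' : frobNorm (X + Y - tensorMul L P (X + Y)) ^ 2 = frobNorm Y ^ 2 :=
    mul_left_cancel₀ hc2.ne' hTP
  set f := frobNorm Y ^ 2 with hf
  set t : Fin n₁ → ℝ := fun j => ∑ k, ‖y k j‖ ^ 2 with ht
  have htube : ∀ j, t j = c ^ 2 * tubeNorm (Y j 0) ^ 2 := fun j => by
    rw [tubeNorm_sq, ← sqNorm_transform hL]; rfl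
  have hF : ∑ j, t j = c ^ 2 * f := by
    rw [hf, ← sum_sqNorm_colSlice hL, Finset.sum_comm]
    rfl
  have ht0 : ∀ j, 0 ≤ t j := fun j => by simp only [ht]; positivity
  set B := c ^ 2 * maxTubeNorm Y ^ 2 with hB
  have htB : ∀ j, t j ≤ B := fun j => by
    rw [htube]
    have h1 : tubeNorm (Y j 0) ≤ maxTubeNorm Y :=
      le_ciSup (f := fun i => tubeNorm (Y i 0)) (Set.finite_range _).bddAbove j
    have h0 : 0 ≤ tubeNorm (Y j 0) := Real.sqrt_nonneg _
    exact mul_le_mul_of_nonneg_left (pow_le_pow_left₀ h0 h1 2) hc2.le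
  have hNB : c ^ 2 * f ≤ n₁ * B := by
    rw [← hF]
    refine (Finset.sum_le_sum fun j _ => htB j).trans (le_of_eq ?_)
    simp
  have hsumt : ∀ s : Fin m → Fin n₁, ∑ k, sqNorm (y k ∘ s) = ∑ i, t (s i) := fun s => by
    simp only [sqNorm, ht, Function.comp]
    exact Finset.sum_comm
  set α := alphaBound m δ Y with hα
  have hαe : 0 < f → α = √(2 * (n₁ * B - c ^ 2 * f) / (m * (c ^ 2 * f)) * ℓ) +
      2 * (n₁ * B - c ^ 2 * f) / (3 * m * (c ^ 2 * f)) * ℓ := by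
    intro hfp
    have e1 : 2 * (n₁ * B - c ^ 2 * f) / (m * (c ^ 2 * f)) =
        2 * (n₁ * maxTubeNorm Y ^ 2 - f) / (m * f) := by
      rw [hB]; field_simp
    have e2 : 2 * (n₁ * B - c ^ 2 * f) / (3 * m * (c ^ 2 * f)) =
        2 * (n₁ * maxTubeNorm Y ^ 2 - f) / (3 * m * f) := by
      rw [hB]; field_simp
    rw [e1, e2]
    rfl
  have hf0 : 0 ≤ f := by positivity
  let A₁ : Finset (Fin m → Fin n₁) := Finset.univ.filter fun s =>
    0 < f ∧ (1 + α) * (m / n₁) * (c ^ 2 * f) < ∑ i, t (s i)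
  let A₂ : Finset (Fin m → Fin n₁) := Finset.univ.filter fun s =>
    0 < f ∧ ∑ i, t (s i) < (m * (1 - α) - 2 / 3 * ℓ) * (c ^ 2 * f / n₁)
  let A₃ : Finset (Fin m → Fin n₁) := Finset.univ.filter fun s =>
    ∃ k v, sqNorm ((Q k).submatrix s id *ᵥ v) < (1 - γ) * m / n₁ * sqNorm v
  -- The case α ≥ 1 is left out: there the lower bound is trivial, while α < 1 is what makes the
  -- vectors short enough for the vector inequality.
  let A₄ : Finset (Fin m → Fin n₁) := Finset.univ.filter fun s =>
    (0 < f ∧ α < 1) ∧ m * (R * (c ^ 2 * f) / n₁) * ((1 + 2 * √ℓ) ^ 2 - 2 / 3 * ℓ) <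
      ∑ k, sqNorm (((Q k).submatrix s id)ᴴ *ᵥ (y k ∘ s))
  have hpow : (0 : ℝ) ≤ (n₁ : ℝ) ^ m * δ := by positivity
  have hA₁ : (A₁.card : ℝ) ≤ (n₁ : ℝ) ^ m * δ := by
    rcases hf0.eq_or_lt with h | hfp
    · simpa [A₁, ← h] using hpow
    · rw [← hexpℓ]
      have := card_sampled_sum_gt_le hm0 ht0 htB hF (by positivity) (by linarith : 0 < ℓ)
        (by rw [Fintype.card_fin]; exact hNB) A₁
        (fun s hs => by
          rw [Fintype.card_fin, ← hαe hfp]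
          exact (Finset.mem_filter.1 hs).2.2)
      rwa [Fintype.card_fin] at this
  have hA₂ : (A₂.card : ℝ) ≤ (n₁ : ℝ) ^ m * δ := by
    rcases hf0.eq_or_lt with h | hfp
    · simpa [A₂, ← h] using hpow
    · rw [← hexpℓ]
      have := card_sampled_sum_lt_le hm0 ht0 htB hF (by positivity) (by linarith : 0 < ℓ)
        (by rw [Fintype.card_fin]; exact hNB) A₂
        (fun s hs => by
          rw [Fintype.card_fin, ← hαe hfp]
          exact (Finset.mem_filter.1 hs).2.2)
      rwa [Fintype.card_fin] at this
  have hA₃ : (A₃.card : ℝ) ≤ (n₁ : ℝ) ^ m * (δ / 2) :=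
    card_sampled_gram_le Q hQ hRp hQR hγ0 hδ hn₂ hn₃ hN (by rw [hNR]; exact hγ2) A₃
      fun s hs => (Finset.mem_filter.1 hs).2
  have hA₄ : (A₄.card : ℝ) ≤ (n₁ : ℝ) ^ m * δ := by
    by_cases hcase : 0 < f ∧ α < 1
    · obtain ⟨hfp, hα1⟩ := hcase
      rw [← hexpℓ]
      refine card_sampled_inner_le Q y hQy hRp hQR hN hm0 htB hF (by positivity) hℓ1 ?_ A₄
        fun s hs => (Finset.mem_filter.1 hs).2.2
      -- With F = c² f, α < 1 gives 2ℓ(n₁B - F) < mF; together with ℓ ≤ (3/8)m this yields ℓ n₁B ≤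
      -- (7/8)mF.
      have hD : 0 ≤ n₁ * B - c ^ 2 * f := by linarith
      rw [hαe hfp] at hα1
      have h0 : 0 ≤ 2 * (n₁ * B - c ^ 2 * f) / (3 * m * (c ^ 2 * f)) * ℓ := by positivity
      have h1 : 2 * (n₁ * B - c ^ 2 * f) / (m * (c ^ 2 * f)) * ℓ < 1 := by
        have h2 : √(2 * (n₁ * B - c ^ 2 * f) / (m * (c ^ 2 * f)) * ℓ) < 1 := by linarith
        rwa [Real.sqrt_lt' one_pos, one_pow] at h2
      rw [div_mul_eq_mul_div, div_lt_one (by positivity)] at h1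
      have h3 := mul_le_mul_of_nonneg_right hℓm (by positivity : 0 ≤ c ^ 2 * f)
      have h4 : 0 < m * (c ^ 2 * f) := by positivity
      linarith
    · simpa [A₄, hcase] using hpow
  refine le_real_of_card_filter_le prob Ω hΩ_indep hΩ_unif
    {s | ∃ PΩ : Tensor3 𝕜 m m n₃, IsColProjection L (sampleRows s U) PΩ ∧
      (m * (1 - α) - Γ * (betaBound δ / (1 - γ))) / n₁ *
          frobNorm (X + Y - tensorMul L P (X + Y)) ^ 2 ≤
        frobNorm (sampleRows s (X + Y) - tensorMul L PΩ (sampleRows s (X + Y))) ^ 2 ∧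
      frobNorm (sampleRows s (X + Y) - tensorMul L PΩ (sampleRows s (X + Y))) ^ 2 ≤
        (1 + α) * (m / n₁) * frobNorm (X + Y - tensorMul L P (X + Y)) ^ 2}
    (A₁ ∪ A₂ ∪ A₃ ∪ A₄) ?_ hN ?_
  · intro s hs
    simp only [Finset.mem_union, not_or, A₁, A₂, A₃, A₄, Finset.mem_filter, Finset.mem_univ,
      true_and, not_and, not_lt, not_exists] at hs
    obtain ⟨⟨⟨h1, h2⟩, h3⟩, h4⟩ := hs
    have hlam : 0 < (1 - γ) * m / n₁ := by
      have : 0 < 1 - γ := by linarith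
      positivity
    obtain ⟨PΩ, hPΩ, hlow, hup⟩ := sampled_residual_bounds (Y := Y) hL hX hC'C hU s hlam h3
    refine ⟨PΩ, hPΩ, ?_⟩
    rw [hTP']
    set E := frobNorm (sampleRows s (X + Y) - tensorMul L PΩ (sampleRows s (X + Y))) ^ 2
    have hE0 : 0 ≤ E := by positivity
    change _ ≤ ∑ k, sqNorm (y k ∘ s) at hup
    change ∑ k, sqNorm (y k ∘ s) - (∑ k, sqNorm (((Q k).submatrix s id)ᴴ *ᵥ (y k ∘ s))) / _ ≤ _
      at hlow
    rw [hsumt] at hup hlow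
    rcases hf0.eq_or_lt with hf' | hfp
    -- For Y = 0 the sampled residual also vanishes, and both inequalities read 0 ≤ 0.
    · have htz : ∀ j, t j = 0 := fun j =>
        (Finset.sum_eq_zero_iff_of_nonneg fun j _ => ht0 j).1 (by rw [hF, ← hf', mul_zero]) j
          (Finset.mem_univ j)
      simp only [htz, Finset.sum_const_zero] at hup
      have hE : E = 0 := le_antisymm (nonpos_of_mul_nonpos_right hup hc2) hE0
      rw [← hf', hE]
      simp
    · have hg1 : 0 < 1 - γ := by linarith
      refine ⟨?_, ?_⟩
      · have hβ : 0 ≤ betaBound δ := by unfold betaBound; positivity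
        rcases le_or_gt 1 α with hα1 | hα1
        · have h5 : 0 ≤ Γ * (betaBound δ / (1 - γ)) := by positivity
          have h6 : m * (1 - α) ≤ 0 := mul_nonpos_of_nonneg_of_nonpos hm'.le (by linarith)
          refine le_trans ?_ hE0
          exact mul_nonpos_of_nonpos_of_nonneg
            (div_nonpos_of_nonpos_of_nonneg (by linarith) hN'.le) hf0
        · have h5 := h2 hfp
          have h6 := h4 ⟨hfp, hα1⟩
          change _ ≤ m * (R * (c ^ 2 * f) / n₁) * (betaBound δ - 2 / 3 * ℓ) at h6
          have h7 := div_le_div_of_nonneg_right h6 hlam.le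
          have e7 : m * (R * (c ^ 2 * f) / n₁) * (betaBound δ - 2 / 3 * ℓ) /
              ((1 - γ) * m / n₁) = Γ * ((betaBound δ - 2 / 3 * ℓ) / (1 - γ)) * (c ^ 2 * f / n₁) := by
            rw [← hNR]; field_simp
          rw [e7] at h7
          -- The (2/3)ℓ saved in β is multiplied by Γ/(1 - γ) ≥ 1, so it covers the (2/3)ℓ lost in
          -- the lower tail.
          have h8 : 2 / 3 * ℓ ≤ Γ * (2 / 3 * ℓ / (1 - γ)) := by
            have h9 : 2 / 3 * ℓ ≤ 2 / 3 * ℓ / (1 - γ) := by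
              rw [le_div_iff₀ hg1]
              exact mul_le_of_le_one_right (by linarith) (by linarith)
            exact h9.trans (le_mul_of_one_le_left (le_trans (by linarith) h9) hΓ1)
          have h10 : (m * (1 - α) - Γ * (betaBound δ / (1 - γ))) * (c ^ 2 * f / n₁) ≤
              (m * (1 - α) - 2 / 3 * ℓ - Γ * ((betaBound δ - 2 / 3 * ℓ) / (1 - γ))) *
                (c ^ 2 * f / n₁) := by
            refine mul_le_mul_of_nonneg_right ?_ (by positivity)
            rw [sub_div, mul_sub]
            linarith
          refine le_of_mul_le_mul_left ?_ hc2
          have e : c ^ 2 * ((m * (1 - α) - Γ * (betaBound δ / (1 - γ))) / n₁ * f) =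
              (m * (1 - α) - Γ * (betaBound δ / (1 - γ))) * (c ^ 2 * f / n₁) := by ring
          rw [e]
          linarith
      · refine le_of_mul_le_mul_left ?_ hc2
        linarith [h1 hfp]
  · have hcard : (((A₁ ∪ A₂ ∪ A₃ ∪ A₄).card : ℕ) : ℝ) ≤ A₁.card + A₂.card + A₃.card + A₄.card := by
      have e1 := Finset.card_union_le (A₁ ∪ A₂ ∪ A₃) A₄
      have e2 := Finset.card_union_le (A₁ ∪ A₂) A₃
      have e3 := Finset.card_union_le A₁ A₂
      exact_mod_cast (by omega : (A₁ ∪ A₂ ∪ A₃ ∪ A₄).card ≤ A₁.card + A₂.card + A₃.card + A₄.card)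
    linarith
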